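/- Let $k$ be a field and let $A$ be a connected DG $k$-algebra, i.e. a cohomologically $\mathbb{Z}$-graded differential graded $k$-algebra with $A^i=0$ for $i<0$ and $A^0=k$. Put $\mathfrak{m}=A^{\ge 1}$. Let $M$ be a left DG $A$-module. A DG $A$-module is DG free if it is isomorphic to a direct sum of suspensions of $A$. A semi-free filtration of a DG $A$-module $F$ is a sequence of DG submodules $0=F(-1)\subseteq F(0)\subseteq F(1)\subseteq\cdots$ with $F=\bigcup_i F(i)$ and all $F(i)/F(i-1)$, $i\ge 0$, DG free; $F$ is semi-free if it has one. The filtration is strictly increasing if $F(i-1)\ne F(i)$ whenever $i\ge 0$ and $F(i-1)\neq F$, and its length is the least $n\in\mathbb{N}=\{0,1,2,\dots\}$ with $F(n)=F$ ($+\infty$ if there is none). The DG free class of a semi-free $F$ is the infimum of all $n\in\mathbb{N}$ such that $F$ has a strictly increasing semi-free filtration of length $n$. A semi-free resolution of $M$ is a quasi-isomorphism $\varepsilon:F\to M$ of DG $A$-modules with $F$ semi-free; it is minimal if $\partial_F(F)\subseteq\mathfrak{m}F$. It is an Eilenberg–Moore resolution if, for some semi-free filtration of $F$, the augmented $E_1$-complex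 $$\cdots\to H(F(2)/F(1))\to H(F(1)/F(0))\to H(F(0))\xrightarrow{H(\varepsilon)}H(M)\to 0,$$ whose maps $H(F(i)/F(i-1))\to H(F(i-1)/F(i-2))$ are $[x]\mapsto[\partial_F x]$, is exact. The cone length $\mathrm{cl}_A M\in\mathbb{N}\cup\{+\infty\}$ is the infimum of the DG free classes of all semi-free resolutions of $M$, and $\mathrm{pd}_{H(A)}H(M)\in\mathbb{N}\cup\{+\infty\}$ is the projective dimension of the graded left $H(A)$-module $H(M)$, i.e. the infimum of all $n\in\mathbb{N}$ such that there is a resolution $0\to P_n\to\cdots\to P_0\to H(M)\to 0$ by graded projective modules (so the zero module has projective dimension $0$). Suppose that $H(M)$ is bounded below, i.e. there is $b\in\mathbb{Z}$ with $H^i(M)=0$ for all $i<b$, and that $M$ admits a minimal Eilenberg–Moore resolution, i.e. an Eilenberg–Moore resolution $\varepsilon:F\to M$ with $\partial_F(F)\subseteq\mathfrak{m}F$. Then $$\mathrm{cl}_A M=\mathrm{pd}_{H(A)}H(M)$$ (as elements of $\mathbb{N}\cup\{+\infty\}$, so in particular one side is finite if and only if the other is). -/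

import Mathlib

universe w u v

/-! ### Gradings -/

/-- A graded left module over a ring `R` graded by the additive subgroups `𝓡 i`, `i ∈ ℤ`. -/
structure GrMod (R : Type u) [Ring R] (𝓡 : ℤ → AddSubgroup R) where
  carrier : Type v
  [addCommGroup : AddCommGroup carrier]
  [module : Module R carrier]
  gr : ℤ → AddSubgroup carrier
  isInternal : DirectSum.IsInternal gr
  smul_mem : ∀ {i j : ℤ} {r : R} {x : carrier}, r ∈ 𝓡 i → x ∈ gr j → r • x ∈ gr (i + j)

attribute [instance] GrMod.addCommGroup GrMod.module

instance {R : Type u} [Ring R] {𝓡 : ℤ → AddSubgroup R} :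
    CoeSort (GrMod.{u, v} R 𝓡) (Type v) := ⟨GrMod.carrier⟩

section GradingLemmas

variable {X : Type u} [AddCommGroup X] {G : ℤ → AddSubgroup X}

/-- The homogeneous component of degree `i`. -/
noncomputable def grComp (h : DirectSum.IsInternal G) (i : ℤ) : X →+ X :=
  letI := h.chooseDecomposition
  AddMonoidHom.mk' (fun x => (DirectSum.decompose G x i : X)) (by intro a b; simp)

theorem grComp_mem (h : DirectSum.IsInternal G) (i : ℤ) (x : X) : grComp h i x ∈ G i := by
  let := h.chooseDecomposition
  exact (DirectSum.decompose G x i).2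

theorem grComp_same (h : DirectSum.IsInternal G) {i : ℤ} {x : X} (hx : x ∈ G i) :
    grComp h i x = x := by
  let := h.chooseDecomposition
  exact DirectSum.decompose_of_mem_same G hx

theorem grComp_ne (h : DirectSum.IsInternal G) {i j : ℤ} {x : X} (hx : x ∈ G i) (hij : i ≠ j) :
    grComp h j x = 0 := by
  let := h.chooseDecomposition
  exact DirectSum.decompose_of_mem_ne G hx hij

theorem exists_sum_grComp (h : DirectSum.IsInternal G) (x : X) :
    ∃ s : Finset ℤ, ∑ i ∈ s, grComp h i x = x := by
  classical
  let := h.chooseDecomposition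
  exact ⟨(DirectSum.decompose G x).support, DirectSum.sum_support_decompose G x⟩

/-- Two additive maps that agree on homogeneous elements are equal. -/
theorem gr_hom_ext (h : DirectSum.IsInternal G) {Y : Type v} [AddCommGroup Y] {f g : X →+ Y}
    (hfg : ∀ i, ∀ x ∈ G i, f x = g x) : f = g := by
  ext x
  obtain ⟨s, hs⟩ := exists_sum_grComp h x
  rw [← hs, map_sum, map_sum]
  exact Finset.sum_congr rfl fun i _ => hfg i _ (grComp_mem h i x)

/-- A map of degree one commutes with taking homogeneous components. -/
theorem grComp_comm (h : DirectSum.IsInternal G) (δ : X →+ X)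
    (hδ : ∀ i, ∀ x ∈ G i, δ x ∈ G (i + 1)) (i : ℤ) (x : X) :
    grComp h (i + 1) (δ x) = δ (grComp h i x) := by
  have : (grComp h (i + 1)).comp δ = δ.comp (grComp h i) := by
    refine gr_hom_ext h fun j y hy => ?_
    by_cases hij : j = i
    · subst hij
      simp [grComp_same h hy, grComp_same h (hδ _ _ hy)]
    · simp [grComp_ne h hy hij, grComp_ne h (hδ _ _ hy) (by lia : j + 1 ≠ i + 1)]
  exact DFunLike.congr_fun this x

/-- Every cocycle is the sum of its homogeneous components, which are cocycles. -/
theorem grComp_cocycle (h : DirectSum.IsInternal G) (δ : X →+ X)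
    (hδ : ∀ i, ∀ x ∈ G i, δ x ∈ G (i + 1)) {x : X} (hx : δ x = 0) (i : ℤ) :
    δ (grComp h i x) = 0 := by
  rw [← grComp_comm h δ hδ, hx, map_zero]

/-- The grading induced on cohomology `Z → H`, presented by a surjection `q` from the cocycles
with kernel the coboundaries, is a direct sum decomposition. -/
theorem cohomology_isInternal (h : DirectSum.IsInternal G) (δ : X →+ X)
    (hδ : ∀ i, ∀ x ∈ G i, δ x ∈ G (i + 1)) {H : Type v} [AddCommGroup H]
    (Z : AddSubgroup X) (hZ : ∀ x, x ∈ Z ↔ δ x = 0) (q : Z →+ H) (hq : Function.Surjective q)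
    (hker : ∀ z : Z, q z = 0 ↔ ∃ y, δ y = z) :
    DirectSum.IsInternal fun i => ((G i).addSubgroupOf Z).map q := by
  classical
  constructor
  · rw [injective_iff_map_eq_zero]
    intro f hf
    have hz : ∀ i, ∃ z : Z, (z : X) ∈ G i ∧ q z = f i := by
      intro i
      obtain ⟨z, hz, hz'⟩ := (f i).2
      exact ⟨z, hz, hz'⟩
    choose z hzG hzq using hz
    have hsum : q (∑ i ∈ f.support, z i) = 0 := by
      rw [map_sum, ← hf, DirectSum.coeAddMonoidHom_eq_dfinsuppSum]
      rw [DFinsupp.sum]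
      exact Finset.sum_congr rfl fun i _ => hzq i
    obtain ⟨y, hy⟩ := (hker _).1 hsum
    ext j
    by_contra hne
    have hj : j ∈ f.support := by
      rw [DFinsupp.mem_support_iff]
      intro h0
      exact hne (by rw [h0]; rfl)
    apply hne
    have hc : grComp h j (∑ i ∈ f.support, (z i : X)) = z j := by
      rw [map_sum, Finset.sum_eq_single_of_mem j hj]
      · exact grComp_same h (hzG j)
      · intro b _ hb
        exact grComp_ne h (hzG b) hb
    have hj1 : grComp h j (δ y) = δ (grComp h (j - 1) y) := by
      have := grComp_comm h δ hδ (j - 1) y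
      rwa [sub_add_cancel] at this
    rw [← hzq j, (hker _).2 ⟨grComp h (j - 1) y, ?_⟩]
    · simp
    · rw [← hj1, hy, ← hc]
      simp
  · intro a
    obtain ⟨x, rfl⟩ := hq a
    obtain ⟨s, hs⟩ := exists_sum_grComp h (x : X)
    have hxZ : ∀ i, grComp h i (x : X) ∈ Z := fun i =>
      (hZ _).2 (grComp_cocycle h δ hδ ((hZ _).1 x.2) i)
    refine ⟨∑ i ∈ s, DirectSum.of (fun i => ((G i).addSubgroupOf Z).map q) i
      ⟨q ⟨grComp h i (x : X), hxZ i⟩, ⟨⟨grComp h i (x : X), hxZ i⟩, grComp_mem h i _, rfl⟩⟩, ?_⟩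
    rw [map_sum]
    simp only [DirectSum.coeAddMonoidHom_of]
    rw [← map_sum]
    congr 1
    ext
    simpa using hs

end GradingLemmas

/-! ### DG algebras and their cohomology -/

/-- A differential graded algebra over the field `k` (cohomological, `ℤ`-graded). -/
structure DGAlgebra (k : Type w) [Field k] where
  carrier : Type u
  [ring : Ring carrier]
  [algebra : Algebra k carrier]
  gr : ℤ → Submodule k carrier
  isInternal : DirectSum.IsInternal fun i => (gr i).toAddSubgroup
  one_mem : (1 : carrier) ∈ gr 0
  mul_mem : ∀ {i j : ℤ} {a b : carrier}, a ∈ gr i → b ∈ gr j → a * b ∈ gr (i + j)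
  d : carrier →ₗ[k] carrier
  d_mem : ∀ {i : ℤ} {a : carrier}, a ∈ gr i → d a ∈ gr (i + 1)
  d_d : ∀ a, d (d a) = 0
  leibniz : ∀ {i : ℤ} {a : carrier} (b : carrier), a ∈ gr i →
    d (a * b) = d a * b + i.negOnePow • (a * d b)

attribute [instance] DGAlgebra.ring DGAlgebra.algebra

namespace DGAlgebra

variable {k : Type w} [Field k]

instance : CoeSort (DGAlgebra.{w, u} k) (Type u) := ⟨DGAlgebra.carrier⟩

variable (A : DGAlgebra.{w, u} k)

/-- `A` is connected: `A^i = 0` for `i < 0` and `A^0 = k`. -/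
structure IsConnected : Prop where
  nontrivial : Nontrivial A
  gr_neg : ∀ i < 0, A.gr i = ⊥
  gr_zero : ∀ a ∈ A.gr 0, ∃ c : k, algebraMap k A c = a

/-- The grading of `A` by additive subgroups. -/
abbrev grAdd (i : ℤ) : AddSubgroup A := (A.gr i).toAddSubgroup

theorem d_mul_of_cocycle (a : A) {b : A} (hb : A.d b = 0) : A.d (a * b) = A.d a * b := by
  have : A.d.toAddMonoidHom.comp (AddMonoidHom.mulRight b)
      = (AddMonoidHom.mulRight b).comp A.d.toAddMonoidHom := by
    refine gr_hom_ext A.isInternal fun i x hx => ?_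
    have := A.leibniz b (show x ∈ A.gr i from hx)
    simpa [hb] using this
  exact DFunLike.congr_fun this a

theorem d_one : A.d 1 = 0 := by
  simpa using A.leibniz 1 A.one_mem

/-- The algebra of cocycles `Z(A)`. -/
def cocycles : Subalgebra k A where
  carrier := {a | A.d a = 0}
  mul_mem' := by
    intro a b ha hb
    simp only [Set.mem_ofPred_eq] at *
    rw [A.d_mul_of_cocycle a hb, ha, zero_mul]
  add_mem' := by
    intro a b ha hb
    simp only [Set.mem_ofPred_eq] at *
    rw [map_add, ha, hb, add_zero]
  algebraMap_mem' := by
    intro c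
    simp [Algebra.algebraMap_eq_smul_one, A.d_one]

theorem grComp_mem_cocycles (a : A.cocycles) (i : ℤ) :
    grComp A.isInternal i (a : A) ∈ A.cocycles :=
  grComp_cocycle A.isInternal A.d.toAddMonoidHom (fun _ _ hx => A.d_mem hx) a.2 i

/-- The ideal of coboundaries `B(A)` in `Z(A)`. -/
def coboundaries : Ideal A.cocycles where
  carrier := {z | ∃ y : A, A.d y = z}
  add_mem' := by
    rintro a b ⟨x, hx⟩ ⟨y, hy⟩
    exact ⟨x + y, by simp [hx, hy]⟩
  zero_mem' := ⟨0, by simp⟩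
  smul_mem' := by
    rintro a b ⟨y, hy⟩
    obtain ⟨s, hs⟩ := exists_sum_grComp A.isInternal (a : A)
    refine ⟨∑ i ∈ s, i.negOnePow • (grComp A.isInternal i (a : A) * y), ?_⟩
    have key : ∀ i, A.d (i.negOnePow • (grComp A.isInternal i (a : A) * y))
        = grComp A.isInternal i (a : A) * b := by
      intro i
      have hz : A.d (grComp A.isInternal i (a : A)) = 0 := A.grComp_mem_cocycles a i
      have hl := A.leibniz y (show grComp A.isInternal i (a : A) ∈ A.gr i from
        grComp_mem A.isInternal i _)
      have hu : A.d (i.negOnePow • (grComp A.isInternal i (a : A) * y))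
          = i.negOnePow • A.d (grComp A.isInternal i (a : A) * y) := by
        simp only [Units.smul_def, map_zsmul]
      rw [hu, hl, hz, zero_mul, zero_add, smul_smul, Int.units_mul_self, one_smul, hy]
    rw [map_sum, Finset.sum_congr rfl fun i _ => key i, ← Finset.sum_mul, hs]
    simp

instance : A.coboundaries.IsTwoSided where
  mul_mem_of_left := by
    rintro a b ⟨y, hy⟩
    exact ⟨y * b, by rw [A.d_mul_of_cocycle y b.2, hy]; rfl⟩

/-- The cohomology algebra `H(A)`. -/
abbrev H : Type u := A.cocycles ⧸ A.coboundaries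

/-- `H^i(A)`: the classes of the cocycles of degree `i`. -/
def HGr (i : ℤ) : AddSubgroup A.H :=
  ((A.grAdd i).addSubgroupOf A.cocycles.toSubring.toAddSubgroup).map
    (Ideal.Quotient.mk A.coboundaries).toAddMonoidHom

end DGAlgebra

/-! ### DG modules -/

/-- A left DG module over the DG algebra `A`. The `k`-structure is the one that comes from
`k → A`; the graded pieces and the differential are automatically `k`-linear. -/
structure DGModule {k : Type w} [Field k] (A : DGAlgebra.{w, u} k) extends
    GrMod.{u, v} A A.grAdd where
  d : carrier →+ carrier
  d_mem : ∀ {i : ℤ} {x : carrier}, x ∈ gr i → d x ∈ gr (i + 1)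
  d_d : ∀ x, d (d x) = 0
  leibniz : ∀ {i : ℤ} {a : A} (x : carrier), a ∈ A.gr i →
    d (a • x) = A.d a • x + i.negOnePow • (a • d x)

namespace DGModule

variable {k : Type w} [Field k] {A : DGAlgebra.{w, u} k}

instance : CoeSort (DGModule.{w, u, v} A) (Type v) := ⟨fun M => M.carrier⟩

variable (M : DGModule.{w, u, v} A)

theorem d_smul_of_cocycle (a : A) {x : M} (hx : M.d x = 0) : M.d (a • x) = A.d a • x := by
  have : M.d.comp ((AddMonoidHom.flip (smulAddHom A M)) x)
      = ((AddMonoidHom.flip (smulAddHom A M)) x).comp A.d.toAddMonoidHom := by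
    refine gr_hom_ext A.isInternal fun i a ha => ?_
    have := M.leibniz x (show a ∈ A.gr i from ha)
    simpa [hx] using this
  exact DFunLike.congr_fun this a

/-- The cocycles `Z(M)`, a module over `Z(A)`. -/
def cocycles : Submodule A.cocycles M where
  carrier := {x | M.d x = 0}
  add_mem' := by
    intro a b ha hb
    simp only [Set.mem_ofPred_eq] at *
    rw [map_add, ha, hb, add_zero]
  zero_mem' := by simp
  smul_mem' := by
    intro a x hx
    have ha : A.d (a : A) = 0 := a.2
    simp only [Set.mem_ofPred_eq] at *
    have := M.d_smul_of_cocycle (a : A) hx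
    rwa [ha, zero_smul] at this

/-- The coboundaries `B(M) ⊆ Z(M)`. -/
def coboundaries : Submodule A.cocycles M.cocycles where
  carrier := {z | ∃ y : M, M.d y = z}
  add_mem' := by
    rintro a b ⟨x, hx⟩ ⟨y, hy⟩
    exact ⟨x + y, by simp [hx, hy]⟩
  zero_mem' := ⟨0, by simp⟩
  smul_mem' := by
    rintro a b ⟨y, hy⟩
    obtain ⟨s, hs⟩ := exists_sum_grComp A.isInternal (a : A)
    refine ⟨∑ i ∈ s, i.negOnePow • (grComp A.isInternal i (a : A) • y), ?_⟩
    have key : ∀ i, M.d (i.negOnePow • (grComp A.isInternal i (a : A) • y))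
        = grComp A.isInternal i (a : A) • (b : M) := by
      intro i
      have hz : A.d (grComp A.isInternal i (a : A)) = 0 := A.grComp_mem_cocycles a i
      have hl := M.leibniz y (show grComp A.isInternal i (a : A) ∈ A.gr i from
        grComp_mem A.isInternal i _)
      have hu : M.d (i.negOnePow • (grComp A.isInternal i (a : A) • y))
          = i.negOnePow • M.d (grComp A.isInternal i (a : A) • y) := by
        simp only [Units.smul_def, map_zsmul]
      rw [hu, hl, hz, zero_smul, zero_add, smul_smul, Int.units_mul_self, one_smul, hy]
    rw [map_sum, Finset.sum_congr rfl fun i _ => key i, ← Finset.sum_smul, hs]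
    rfl

/-- The underlying module of the cohomology `H(M)`. -/
def HCarrier : Type v := M.cocycles ⧸ M.coboundaries

instance : AddCommGroup M.HCarrier := inferInstanceAs (AddCommGroup (M.cocycles ⧸ M.coboundaries))

instance : Module A.cocycles M.HCarrier :=
  inferInstanceAs (Module A.cocycles (M.cocycles ⧸ M.coboundaries))

theorem isTorsionBySet_coboundaries :
    Module.IsTorsionBySet A.cocycles M.HCarrier A.coboundaries := by
  intro x a
  obtain ⟨x, rfl⟩ := Submodule.Quotient.mk_surjective _ x
  obtain ⟨⟨a, ha⟩, y, hy⟩ := a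
  refine (Submodule.Quotient.mk_eq_zero M.coboundaries).2 ?_
  refine ⟨y • (x : M), ?_⟩
  have hx : M.d (x : M) = 0 := x.2
  rw [M.d_smul_of_cocycle y hx, hy]
  rfl

/-- `H(M)` as a module over `H(A)`: `[a][x] = [ax]`. -/
instance : Module A.H M.HCarrier :=
  Module.IsTorsionBySet.module M.isTorsionBySet_coboundaries

/-- The class of a cocycle. -/
def cls : M.cocycles →+ M.HCarrier := (Submodule.mkQ M.coboundaries).toAddMonoidHom

theorem cls_surjective : Function.Surjective M.cls := Submodule.mkQ_surjective M.coboundaries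

theorem cls_eq_zero_iff (z : M.cocycles) : M.cls z = 0 ↔ ∃ y : M, M.d y = z :=
  Submodule.Quotient.mk_eq_zero M.coboundaries

theorem mk_smul_cls (a : A.cocycles) (z : M.cocycles) :
    (Ideal.Quotient.mk A.coboundaries a : A.H) • M.cls z = M.cls (a • z) := rfl

/-- The graded `H(A)`-module `H(M)`. -/
def H : GrMod.{u, v} A.H A.HGr where
  carrier := M.HCarrier
  gr i := ((M.gr i).addSubgroupOf M.cocycles.toAddSubgroup).map M.cls
  isInternal := cohomology_isInternal M.isInternal M.d (fun _ _ hx => M.d_mem hx)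
    M.cocycles.toAddSubgroup (fun _ => Iff.rfl) M.cls M.cls_surjective M.cls_eq_zero_iff
  smul_mem := by
    rintro i j _ _ ⟨a, ha, rfl⟩ ⟨z, hz, rfl⟩
    exact ⟨(show A.cocycles from a) • (show M.cocycles from z),
      M.smul_mem (show (a : A) ∈ A.grAdd i from ha) (show (z : M) ∈ M.gr j from hz), rfl⟩

/-- `H(M)` is bounded below: `H^i(M) = 0` for all sufficiently negative `i`. -/
def CohomologyBoundedBelow : Prop := ∃ b : ℤ, ∀ i < b, M.H.gr i = ⊥

end DGModule

/-- A morphism of DG `A`-modules: `A`-linear, of degree zero, commuting with differentials. -/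
structure DGHom {k : Type w} [Field k] {A : DGAlgebra.{w, u} k} (M N : DGModule.{w, u, v} A) where
  toFun : M →ₗ[A] N
  map_gr : ∀ {i : ℤ} {x : M}, x ∈ M.gr i → toFun x ∈ N.gr i
  map_d : ∀ x, toFun (M.d x) = N.d (toFun x)

namespace DGHom

variable {k : Type w} [Field k] {A : DGAlgebra.{w, u} k} {M N : DGModule.{w, u, v} A}

/-- The map induced on cocycles. -/
def mapCocycles (f : DGHom M N) : M.cocycles →ₗ[A.cocycles] N.cocycles where
  toFun z := ⟨f.toFun z, by
    have hz : M.d (z : M) = 0 := z.2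
    change N.d (f.toFun z) = 0
    rw [← f.map_d, hz, map_zero]⟩
  map_add' x y := by ext; simp
  map_smul' a x := by
    ext
    exact f.toFun.map_smul (a : A) (x : M)

theorem mapCocycles_coboundaries (f : DGHom M N) :
    M.coboundaries ≤ N.coboundaries.comap f.mapCocycles := by
  rintro z ⟨y, hy⟩
  exact ⟨f.toFun y, by rw [← f.map_d, hy]; rfl⟩

/-- The map `H(f) : H(M) → H(N)`, `[z] ↦ [f z]`. -/
def mapH (f : DGHom M N) : M.H →ₗ[A.H] N.H where
  toFun := Submodule.mapQ M.coboundaries N.coboundaries f.mapCocycles f.mapCocycles_coboundaries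
  map_add' x y := map_add _ x y
  map_smul' a x := by
    obtain ⟨a, rfl⟩ := Ideal.Quotient.mk_surjective a
    exact (Submodule.mapQ M.coboundaries N.coboundaries f.mapCocycles
      f.mapCocycles_coboundaries).map_smul a (show M.cocycles ⧸ M.coboundaries from x)

/-- `f` is a quasi-isomorphism. -/
def IsQuasiIso (f : DGHom M N) : Prop := Function.Bijective f.mapH

end DGHom

/-! ### Semi-free DG modules -/

namespace DGModule

variable {k : Type w} [Field k] {A : DGAlgebra.{w, u} k} (F : DGModule.{w, u, u} A)

/-- `N` is a DG submodule: stable under the differential and generated additively by its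
homogeneous elements. -/
structure IsDGSubmodule (N : Submodule A F) : Prop where
  d_mem : ∀ x ∈ N, F.d x ∈ N
  homogeneous : N.toAddSubgroup ≤ ⨆ i, (F.gr i ⊓ N.toAddSubgroup)

/-- For DG submodules `N' ≤ N`, the quotient DG module `N / N'` is DG free, i.e. isomorphic to a
direct sum of suspensions of `A`: it has an `A`-basis consisting of homogeneous cocycles. (An
element of `N / N'` is homogeneous of degree `i` when it has a representative of degree `i` in `N`,
and it is a cocycle when the differential of a representative lies in `N'`.) -/
def IsDGFreeQuotient (N N' : Submodule A F) : Prop :=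
  ∃ (ι : Type u) (deg : ι → ℤ) (e : ι → N) (b : Module.Basis ι A (N ⧸ N'.submoduleOf N)),
    ∀ j, b j = Submodule.Quotient.mk (e j) ∧ (e j : F) ∈ F.gr (deg j) ∧ F.d (e j) ∈ N'

/-- The predecessor `F(i-1)` of `F(i)` in a filtration, with `F(-1) = 0`. -/
def prev {F : DGModule.{w, u, u} A} (fil : ℕ → Submodule A F) : ℕ → Submodule A F
  | 0 => ⊥
  | i + 1 => fil i

/-- A semi-free filtration `0 = F(-1) ⊆ F(0) ⊆ F(1) ⊆ ⋯` of `F`: an exhaustive filtration by DG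
submodules with DG free subquotients. -/
structure SemiFreeFiltration where
  fil : ℕ → Submodule A F
  mono : Monotone fil
  isDGSubmodule : ∀ i, F.IsDGSubmodule (fil i)
  exhaustive : ∀ x : F, ∃ i, x ∈ fil i
  free : ∀ i, F.IsDGFreeQuotient (fil i) (prev fil i)

/-- `F` is semi-free. -/
def IsSemiFree : Prop := Nonempty F.SemiFreeFiltration

variable {F}

/-- The filtration is strictly increasing: `F(i-1) ≠ F(i)` whenever `F(i-1) ≠ F`. -/
def SemiFreeFiltration.IsStrict (Φ : F.SemiFreeFiltration) : Prop :=
  ∀ i, prev Φ.fil i ≠ ⊤ → prev Φ.fil i ≠ Φ.fil i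

/-- The filtration has length `n`: `n` is the least natural number with `F(n) = F`. -/
def SemiFreeFiltration.HasLength (Φ : F.SemiFreeFiltration) (n : ℕ) : Prop :=
  Φ.fil n = ⊤ ∧ ∀ m < n, Φ.fil m ≠ ⊤

variable (F)

/-- The DG free class of `F`, possibly `∞`. -/
noncomputable def dgFreeClass : ℕ∞ :=
  sInf {c | ∃ (n : ℕ) (Φ : F.SemiFreeFiltration), c = n ∧ Φ.IsStrict ∧ Φ.HasLength n}

variable {F}

/-- `ε : F → M` is a semi-free resolution. -/
structure IsSemiFreeResolution {M : DGModule.{w, u, u} A} (ε : DGHom F M) : Prop where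
  semiFree : F.IsSemiFree
  quasiIso : ε.IsQuasiIso

/-- The cone length of `M`: the infimum of the DG free classes of its semi-free resolutions. -/
noncomputable def coneLength (M : DGModule.{w, u, u} A) : ℕ∞ :=
  sInf {c | ∃ (F : DGModule.{w, u, u} A) (ε : DGHom F M),
    IsSemiFreeResolution ε ∧ c = F.dgFreeClass}

/-! ### Minimal Eilenberg–Moore resolutions -/

variable (F) in
/-- The submodule `𝔪 F`, where `𝔪` is the span of the elements of `A` of positive degree. -/
def maximalIdealSMul : Submodule A F :=
  Submodule.span A {y | ∃ i : ℤ, 0 < i ∧ ∃ a ∈ A.gr i, ∃ x : F, y = a • x}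

variable (F) in
/-- Minimality: `∂(F) ⊆ 𝔪 F`. -/
def IsMinimal : Prop := ∀ x : F, F.d x ∈ F.maximalIdealSMul

namespace SemiFreeFiltration

variable (Φ : F.SemiFreeFiltration)

/-- The elements of `F(i)` that represent cocycles of `F(i)/F(i-1)`. -/
def relCocycles (i : ℕ) : AddSubgroup F where
  carrier := {x | x ∈ Φ.fil i ∧ F.d x ∈ prev Φ.fil i}
  add_mem' := by
    rintro x y ⟨hx, hx'⟩ ⟨hy, hy'⟩
    exact ⟨add_mem hx hy, by rw [map_add]; exact add_mem hx' hy'⟩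
  zero_mem' := ⟨zero_mem _, by rw [map_zero]; exact zero_mem _⟩
  neg_mem' := by
    rintro x ⟨hx, hx'⟩
    exact ⟨neg_mem hx, by rw [map_neg]; exact neg_mem hx'⟩

/-- The elements of `F(i)` that represent coboundaries of `F(i)/F(i-1)`: `F(i-1) + ∂ F(i)`. -/
def relCoboundaries (i : ℕ) : AddSubgroup F :=
  (prev Φ.fil i).toAddSubgroup ⊔ (Φ.fil i).toAddSubgroup.map F.d

/-- The column `E₁^{-i,*} = H(F(i)/F(i-1))` of the spectral sequence of the filtration. -/
abbrev E1 (i : ℕ) : Type u :=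
  Φ.relCocycles i ⧸ (Φ.relCoboundaries i).addSubgroupOf (Φ.relCocycles i)

/-- `x ↦ ∂x` from representatives of cocycles of `F(i+1)/F(i)` to those of `F(i)/F(i-1)`. -/
def d1Rep (i : ℕ) : Φ.relCocycles (i + 1) →+ Φ.relCocycles i :=
  (F.d.comp (Φ.relCocycles (i + 1)).subtype).codRestrict (Φ.relCocycles i) fun x =>
    ⟨x.2.2, by
      change F.d (F.d (x : F)) ∈ _
      rw [F.d_d]
      exact zero_mem _⟩

theorem d1Rep_coboundaries (i : ℕ) :
    (Φ.relCoboundaries (i + 1)).addSubgroupOf (Φ.relCocycles (i + 1)) ≤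
      ((Φ.relCoboundaries i).addSubgroupOf (Φ.relCocycles i)).comap (Φ.d1Rep i) := by
  intro x hx
  obtain ⟨y, hy, z, ⟨t, _, rfl⟩, hyz⟩ := AddSubgroup.mem_sup.1 (AddSubgroup.mem_addSubgroupOf.1 hx)
  change F.d (x : F) ∈ Φ.relCoboundaries i
  rw [← hyz, map_add, F.d_d, add_zero]
  exact AddSubgroup.mem_sup_right ⟨y, hy, rfl⟩

/-- The differential `d₁ : E₁^{-(i+1),*} → E₁^{-i,*}`, `[x] ↦ [∂x]`. -/
def d1 (i : ℕ) : Φ.E1 (i + 1) →+ Φ.E1 i :=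
  QuotientAddGroup.map _ _ (Φ.d1Rep i) (Φ.d1Rep_coboundaries i)

variable {M : DGModule.{w, u, u} A} (ε : DGHom F M)

/-- `ε` restricted to the cocycles of `F(0)`. -/
def augRep : Φ.relCocycles 0 →+ M.cocycles :=
  (ε.toFun.toAddMonoidHom.comp (Φ.relCocycles 0).subtype).codRestrict M.cocycles fun x => by
    have hx : F.d (x : F) = 0 := x.2.2
    change M.d (ε.toFun (x : F)) = 0
    rw [← ε.map_d, hx, map_zero]

theorem augRep_coboundaries :
    (Φ.relCoboundaries 0).addSubgroupOf (Φ.relCocycles 0) ≤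
      (M.cls.comp (Φ.augRep ε)).ker := by
  intro x hx
  obtain ⟨y, hy, z, ⟨t, _, rfl⟩, hyz⟩ := AddSubgroup.mem_sup.1 (AddSubgroup.mem_addSubgroupOf.1 hx)
  have hy0 : y = 0 := hy
  refine (M.cls_eq_zero_iff _).2 ⟨ε.toFun t, ?_⟩
  change M.d (ε.toFun t) = ε.toFun (x : F)
  rw [← ε.map_d, ← hyz, hy0, zero_add]

/-- The augmentation `E₁^{0,*} = H(F(0)) → H(M)`, `[x] ↦ [ε x]`. -/
def aug : Φ.E1 0 →+ M.H :=
  QuotientAddGroup.lift _ (M.cls.comp (Φ.augRep ε)) (Φ.augRep_coboundaries ε)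

/-- The complex `⋯ → E₁^{-2,*} → E₁^{-1,*} → E₁^{0,*} → H(M) → 0` is exact. -/
structure E1Exact : Prop where
  surjective_aug : Function.Surjective (Φ.aug ε)
  exact_zero : Function.Exact (Φ.d1 0) (Φ.aug ε)
  exact_succ : ∀ i, Function.Exact (Φ.d1 (i + 1)) (Φ.d1 i)

end SemiFreeFiltration

/-- `ε : F → M` is an Eilenberg–Moore resolution: a semi-free resolution with a semi-free
filtration whose augmented `E₁`-complex is exact. -/
structure IsEilenbergMooreResolution {M : DGModule.{w, u, u} A} (ε : DGHom F M) : Prop where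
  quasiIso : ε.IsQuasiIso
  exact : ∃ Φ : F.SemiFreeFiltration, Φ.E1Exact ε

/-- `M` admits a minimal Eilenberg–Moore resolution. -/
def AdmitsMinimalEilenbergMooreResolution (M : DGModule.{w, u, u} A) : Prop :=
  ∃ (F : DGModule.{w, u, u} A) (ε : DGHom F M), IsEilenbergMooreResolution ε ∧ F.IsMinimal

end DGModule

/-! ### Projective dimension of graded modules -/

namespace GrMod

variable {R : Type u} [Ring R] {𝓡 : ℤ → AddSubgroup R}

/-- `N` has a resolution `0 → P n → ⋯ → P 0 → N → 0` of length at most `n` by graded projective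
modules and morphisms of degree zero. (A graded module is projective in the category of graded
modules if and only if its underlying module is projective.) -/
def HasProjectiveResolution (N : GrMod.{u, u} R 𝓡) (n : ℕ) : Prop :=
  ∃ (P : ℕ → GrMod.{u, u} R 𝓡) (δ : ∀ i, P (i + 1) →ₗ[R] P i) (ε : P 0 →ₗ[R] N),
    (∀ i, Module.Projective R (P i)) ∧
    (∀ i j, ∀ x ∈ (P (i + 1)).gr j, δ i x ∈ (P i).gr j) ∧
    (∀ j, ∀ x ∈ (P 0).gr j, ε x ∈ N.gr j) ∧
    Function.Surjective ε ∧ Function.Exact (δ 0) ε ∧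
    (∀ i, Function.Exact (δ (i + 1)) (δ i)) ∧
    ∀ i, n < i → Subsingleton (P i)

/-- The projective dimension of the graded module `N`, with value `0` for `N = 0`. -/
noncomputable def projectiveDimension (N : GrMod.{u, u} R 𝓡) : ℕ∞ :=
  sInf {c | ∃ n : ℕ, c = n ∧ N.HasProjectiveResolution n}

end GrMod

/-! Let `F → M` be the given minimal Eilenberg–Moore resolution and `Φ` a filtration of `F` with
exact augmented `E₁`-complex. A basis of `F` adapted to `Φ` (`nonempty_levelBasis`) splits into sets
`ι i`, one per level. Both invariants turn out to be governed by the last nonempty level: each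
inequality is proved by showing that a bound `n` on one side forces `ι m` to be empty for all `m >
n`.

Cone length bounds projective dimension. Let `G → M` be a semi-free resolution with a filtration
that ends at `n`. Exactness of the `E₁`-complex says that cocycles are represented in `F(0)`, and
that a cocycle of `F(i-1)` bounding in `F` already bounds in `F(i)` (`E1Exact.exists_d_eq`). These
are exactly the conditions for the obstruction theory of `exists_filtered_lift` to give a filtered
quasi-isomorphism `g : G → F`, so that the image of `g` lies in `F(n)`. Some `f' : F → G` satisfies
`g f' ≃ id`, and since `F` is minimal the homotopy contributes only elements of `𝔪F`. On a basis
vector of level `m > n` the coordinate of `g f'` along that vector vanishes while that of the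
identity is a unit, which is absurd (`isEmpty_of_isSemiFreeResolution`). Hence the `E₁`-complex, a
resolution of `H(M)` by graded free `H(A)`-modules, stops at `n`.

Projective dimension bounds cone length. In the adapted basis the `E₁`-complex is a free resolution
whose differentials have coordinates in the ideal of classes without degree-zero component
(`freeD_mem_HIdealFree`). If `H(M)` has a projective resolution of length `n`, dimension shifting
makes the cokernel of `Q(n+1) → Q(n)` projective (`projective_quotient_range_of_resolution`). The
differential then has a generalized inverse, so every element of `Q(n+1)` has coordinates in that
proper ideal, and the basis is empty (`isEmpty_of_projective`). Therefore `F(n) = F`, and minimality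
makes `Φ` strict (`isStrict_of_isMinimal`), so `F` has DG free class at most `n`. -/

/-! ### Parity involution and homogeneous components. -/

section Parity

variable {X : Type u} [AddCommGroup X] {G : ℤ → AddSubgroup X}

/-- A family of subgroups with compatible component projections is a direct sum decomposition. -/
theorem isInternal_of_components (c : ℤ → X →+ X) (hmem : ∀ i x, c i x ∈ G i)
    (hsame : ∀ i, ∀ x ∈ G i, c i x = x) (hne : ∀ i j, ∀ x ∈ G i, i ≠ j → c j x = 0)
    (hsum : ∀ x, ∃ s : Finset ℤ, ∑ i ∈ s, c i x = x) : DirectSum.IsInternal G := by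
  classical
  constructor
  · rw [injective_iff_map_eq_zero]
    intro f hf
    ext j
    have h := congrArg (c j) hf
    rw [DirectSum.coeAddMonoidHom_eq_dfinsuppSum, DFinsupp.sum, map_sum, map_zero] at h
    rw [← hsame j _ (f j).2]
    by_cases hj : j ∈ f.support
    · rwa [Finset.sum_eq_single_of_mem j hj fun b _ hb => hne b j _ (f b).2 hb] at h
    · rw [DFinsupp.notMem_support_iff.1 hj]
      simp
  · intro x
    obtain ⟨s, hs⟩ := hsum x
    refine ⟨∑ i ∈ s, DirectSum.of (fun i => G i) i ⟨c i x, hmem i x⟩, ?_⟩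
    rw [map_sum]
    simpa only [DirectSum.coeAddMonoidHom_of] using hs

/-- The involution that multiplies elements of degree `i` by `(-1)^i`. -/
noncomputable def parity (h : DirectSum.IsInternal G) : X →+ X :=
  letI := h.chooseDecomposition
  (DirectSum.toAddMonoid fun i => ((i.negOnePow : ℤˣ) : ℤ) • (G i).subtype).comp
    (DirectSum.decomposeAddEquiv G).toAddMonoidHom

theorem parity_of_mem (h : DirectSum.IsInternal G) {i : ℤ} {x : X} (hx : x ∈ G i) :
    parity h x = i.negOnePow • x := by
  let := h.chooseDecomposition
  lift x to G i using hx
  simp [parity, Units.smul_def]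

theorem parity_parity (h : DirectSum.IsInternal G) (x : X) : parity h (parity h x) = x := by
  have : (parity h).comp (parity h) = AddMonoidHom.id X := by
    refine gr_hom_ext h fun i y hy => ?_
    have hy' : i.negOnePow • y ∈ G i := by
      rw [Units.smul_def]
      exact zsmul_mem hy _
    simp [parity_of_mem h hy, parity_of_mem h hy', smul_smul]
  exact DFunLike.congr_fun this x

theorem parity_degree_one (h : DirectSum.IsInternal G) (δ : X →+ X)
    (hδ : ∀ i, ∀ x ∈ G i, δ x ∈ G (i + 1)) (x : X) : parity h (δ x) = -δ (parity h x) := by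
  have : (parity h).comp δ = -(δ.comp (parity h)) := by
    refine gr_hom_ext h fun i y hy => ?_
    simp [parity_of_mem h hy, parity_of_mem h (hδ _ _ hy), Int.negOnePow_succ, Units.smul_def]
  exact DFunLike.congr_fun this x

/-- A subgroup stable under homogeneous components is stable under the parity involution. -/
theorem parity_mem (h : DirectSum.IsInternal G) {N : AddSubgroup X} {x : X}
    (hN : ∀ i, grComp h i x ∈ N) : parity h x ∈ N := by
  obtain ⟨s, hs⟩ := exists_sum_grComp h x
  rw [← hs, map_sum]
  refine sum_mem fun i _ => ?_
  rw [parity_of_mem h (grComp_mem h i x), Units.smul_def]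
  exact zsmul_mem (hN i) _

theorem grComp_degree_zero (h : DirectSum.IsInternal G) {Y : Type v} [AddCommGroup Y]
    {G' : ℤ → AddSubgroup Y} (h' : DirectSum.IsInternal G') (f : X →+ Y)
    (hf : ∀ i, ∀ x ∈ G i, f x ∈ G' i) (i : ℤ) (x : X) :
    grComp h' i (f x) = f (grComp h i x) := by
  have : (grComp h' i).comp f = f.comp (grComp h i) := by
    refine gr_hom_ext h fun j y hy => ?_
    by_cases hij : j = i
    · subst hij
      simp [grComp_same h hy, grComp_same h' (hf _ _ hy)]
    · simp [grComp_ne h hy hij, grComp_ne h' (hf _ _ hy) hij]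
  exact DFunLike.congr_fun this x

theorem parity_degree_zero (h : DirectSum.IsInternal G) {Y : Type v} [AddCommGroup Y]
    {G' : ℤ → AddSubgroup Y} (h' : DirectSum.IsInternal G') (f : X →+ Y)
    (hf : ∀ i, ∀ x ∈ G i, f x ∈ G' i) (x : X) : parity h' (f x) = f (parity h x) := by
  have : (parity h').comp f = f.comp (parity h) := by
    refine gr_hom_ext h fun j y hy => ?_
    simp [parity_of_mem h hy, parity_of_mem h' (hf _ _ hy), Units.smul_def]
  exact DFunLike.congr_fun this x

end Parity

/-! ### The degree-zero part of a connected DG algebra. -/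

namespace DGAlgebra

variable {k : Type w} [Field k] (A : DGAlgebra.{w, u} k)

/-- The parity involution of a DG algebra. -/
noncomputable abbrev par : A →+ A := parity A.isInternal

variable {A}

/-- In a connected DG algebra, taking the component of degree `0` is multiplicative. -/
theorem grComp_zero_mul (hA : A.IsConnected) (a b : A) :
    grComp A.isInternal 0 (a * b) = grComp A.isInternal 0 a * grComp A.isInternal 0 b := by
  have neg : ∀ i < 0, ∀ x ∈ A.grAdd i, x = 0 := by
    intro i hi x hx
    have hx' : x ∈ A.gr i := hx
    simpa [hA.gr_neg i hi] using hx'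
  have : (grComp A.isInternal 0).comp (AddMonoidHom.mulRight b)
      = (AddMonoidHom.mulRight (grComp A.isInternal 0 b)).comp (grComp A.isInternal 0) := by
    refine gr_hom_ext A.isInternal fun i x hx => ?_
    have : (grComp A.isInternal 0).comp (AddMonoidHom.mulLeft x)
        = (AddMonoidHom.mulLeft (grComp A.isInternal 0 x)).comp (grComp A.isInternal 0) := by
      refine gr_hom_ext A.isInternal fun j y hy => ?_
      have hxy : x * y ∈ A.grAdd (i + j) := A.mul_mem hx hy
      simp only [AddMonoidHom.comp_apply, AddMonoidHom.coe_mulLeft]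
      by_cases hi : i = 0
      · subst hi
        rw [grComp_same A.isInternal hx]
        by_cases hj : j = 0
        · subst hj
          rw [grComp_same A.isInternal hy]
          exact grComp_same A.isInternal (by simpa using hxy)
        · rw [grComp_ne A.isInternal hy hj, mul_zero]
          exact grComp_ne A.isInternal hxy (by simpa using hj)
      · rw [grComp_ne A.isInternal hx hi, zero_mul]
        by_cases hij : i + j = 0
        -- Two nonzero degrees adding up to zero: one factor has negative degree, hence vanishes.
        · rcases lt_or_gt_of_ne hi with h | h
          · rw [neg i h x hx]; simp
          · rw [neg j (by lia) y hy]; simp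
        · exact grComp_ne A.isInternal hxy hij
    simpa using DFunLike.congr_fun this b
  simpa using DFunLike.congr_fun this a

/-- Only `A^{-1} = 0` could map to degree zero. This is what keeps the unit from being a coboundary
modulo positive degrees. -/
theorem grComp_zero_d (hA : A.IsConnected) (a : A) : grComp A.isInternal 0 (A.d a) = 0 := by
  have h := grComp_comm A.isInternal A.d.toAddMonoidHom (fun _ _ hx => A.d_mem hx) (-1) a
  have h0 : grComp A.isInternal (-1) a ∈ A.gr (-1) := grComp_mem A.isInternal (-1) a
  rw [hA.gr_neg (-1) (by lia), Submodule.mem_bot] at h0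
  rw [h0] at h
  simpa using h

end DGAlgebra

/-! ### Sign rules and components in DG modules; quasi-isomorphisms by cocycles. -/

namespace DGModule

variable {k : Type w} [Field k] {A : DGAlgebra.{w, u} k} (M : DGModule.{w, u, v} A)

/-- The parity involution of a DG module. -/
noncomputable abbrev par : M →+ M := parity M.isInternal

/-- The homogeneous component of degree `i` in a DG module. -/
noncomputable abbrev comp (i : ℤ) : M →+ M := grComp M.isInternal i

variable {M}

/-- With the sign absorbed in the parity involution, both sides are additive in `a`, so the Leibniz
rule needs no homogeneity. Later computations with arbitrary coefficients rest on this form. -/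
theorem d_smul (a : A) (x : M) : M.d (a • x) = A.d a • x + A.par a • M.d x := by
  have : M.d.comp ((AddMonoidHom.flip (smulAddHom A M)) x)
      = ((AddMonoidHom.flip (smulAddHom A M)) x).comp A.d.toAddMonoidHom
        + ((AddMonoidHom.flip (smulAddHom A M)) (M.d x)).comp A.par := by
    refine gr_hom_ext A.isInternal fun i a ha => ?_
    have := M.leibniz x (show a ∈ A.gr i from ha)
    have hp : A.par a = i.negOnePow • a := parity_of_mem A.isInternal ha
    change M.d (a • x) = A.d a • x + A.par a • M.d x
    rw [this, hp, Units.smul_def, Units.smul_def, smul_assoc]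
  exact DFunLike.congr_fun this a

theorem par_smul (a : A) (x : M) : M.par (a • x) = A.par a • M.par x := by
  have : M.par.comp ((AddMonoidHom.flip (smulAddHom A M)) x)
      = ((AddMonoidHom.flip (smulAddHom A M)) (M.par x)).comp A.par := by
    refine gr_hom_ext A.isInternal fun i a ha => ?_
    have hp : A.par a = i.negOnePow • a := parity_of_mem A.isInternal ha
    have : M.par.comp (smulAddHom A M a)
        = (smulAddHom A M (A.par a)).comp M.par := by
      refine gr_hom_ext M.isInternal fun j x hx => ?_
      have hax : M.par (a • x) = (i + j).negOnePow • (a • x) :=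
        parity_of_mem M.isInternal (M.smul_mem ha hx)
      have hx' : M.par x = j.negOnePow • x := parity_of_mem M.isInternal hx
      change M.par (a • x) = A.par a • M.par x
      rw [hax, hx', hp, Int.negOnePow_add, mul_smul]
      simp only [Units.smul_def]
      rw [smul_assoc, smul_comm a]
    exact DFunLike.congr_fun this x
  exact DFunLike.congr_fun this a

theorem par_d (x : M) : M.par (M.d x) = -M.d (M.par x) :=
  parity_degree_one M.isInternal M.d (fun _ _ hx => M.d_mem hx) x

theorem comp_d (i : ℤ) (x : M) : M.comp (i + 1) (M.d x) = M.d (M.comp i x) :=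
  grComp_comm M.isInternal M.d (fun _ _ hx => M.d_mem hx) i x

theorem comp_smul {i : ℤ} (a : A) {x : M} (hx : x ∈ M.gr i) (j : ℤ) :
    M.comp j (a • x) = grComp A.isInternal (j - i) a • x := by
  have : (M.comp j).comp ((AddMonoidHom.flip (smulAddHom A M)) x)
      = ((AddMonoidHom.flip (smulAddHom A M)) x).comp (grComp A.isInternal (j - i)) := by
    refine gr_hom_ext A.isInternal fun l a ha => ?_
    have hax : a • x ∈ M.gr (l + i) := M.smul_mem ha hx
    by_cases hl : l = j - i
    · subst hl
      rw [sub_add_cancel] at hax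
      simp [grComp_same A.isInternal ha, grComp_same M.isInternal hax]
    · simp [grComp_ne A.isInternal ha hl, grComp_ne M.isInternal hax (by lia : l + i ≠ j)]
  exact DFunLike.congr_fun this a

end DGModule

namespace DGHom

variable {k : Type w} [Field k] {A : DGAlgebra.{w, u} k} {M N : DGModule.{w, u, v} A}

theorem map_par (f : DGHom M N) (x : M) : f.toFun (M.par x) = N.par (f.toFun x) :=
  (parity_degree_zero M.isInternal N.isInternal f.toFun.toAddMonoidHom
    (fun _ _ hx => f.map_gr hx) x).symm

theorem map_comp (f : DGHom M N) (i : ℤ) (x : M) :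
    f.toFun (M.comp i x) = N.comp i (f.toFun x) :=
  (grComp_degree_zero M.isInternal N.isInternal f.toFun.toAddMonoidHom
    (fun _ _ hx => f.map_gr hx) i x).symm

/-- Quasi-isomorphisms in terms of cocycles and coboundaries. -/
theorem isQuasiIso_iff (f : DGHom M N) : f.IsQuasiIso ↔
    (∀ z, N.d z = 0 → ∃ x, M.d x = 0 ∧ ∃ m, z = f.toFun x + N.d m) ∧
    (∀ c, M.d c = 0 → (∃ m, f.toFun c = N.d m) → ∃ y, M.d y = c) := by
  have hcls : ∀ x : M.cocycles, f.mapH (M.cls x) = N.cls (f.mapCocycles x) := fun _ => rfl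
  constructor
  · rintro ⟨hi, hs⟩
    refine ⟨fun z hz => ?_, fun c hc ⟨m, hm⟩ => ?_⟩
    · obtain ⟨y, hy⟩ := hs (N.cls ⟨z, hz⟩)
      obtain ⟨x, rfl⟩ := M.cls_surjective y
      rw [hcls] at hy
      have h0 : N.cls (⟨z, hz⟩ - f.mapCocycles x) = 0 := by
        rw [map_sub, sub_eq_zero]
        exact hy.symm
      obtain ⟨m, hm⟩ := (N.cls_eq_zero_iff _).1 h0
      refine ⟨x, x.2, m, ?_⟩
      rw [hm]
      exact (add_sub_cancel (f.toFun x) z).symm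
    · let z : M.cocycles := ⟨c, hc⟩
      have h0 : N.cls (f.mapCocycles z) = 0 := (N.cls_eq_zero_iff _).2 ⟨m, hm.symm⟩
      exact (M.cls_eq_zero_iff z).1 (hi (h0.trans (map_zero f.mapH).symm))
  · rintro ⟨hs, hi⟩
    constructor
    · rw [injective_iff_map_eq_zero]
      intro y hy
      obtain ⟨x, rfl⟩ := M.cls_surjective y
      rw [hcls] at hy
      obtain ⟨m, hm⟩ := (N.cls_eq_zero_iff _).1 hy
      exact (M.cls_eq_zero_iff x).2 (hi x x.2 ⟨m, hm.symm⟩)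
    · intro y
      obtain ⟨z, rfl⟩ := N.cls_surjective y
      obtain ⟨x, hx, m, hm⟩ := hs z z.2
      let t : M.cocycles := ⟨x, hx⟩
      have h0 : N.cls (f.mapCocycles t - z) = 0 := by
        refine (N.cls_eq_zero_iff _).2 ⟨-m, ?_⟩
        change N.d (-m) = f.toFun x - z
        rw [hm, map_neg]
        abel
      rw [map_sub] at h0
      exact ⟨M.cls t, sub_eq_zero.1 h0⟩

end DGHom

/-! ### Bases adapted to a semi-free filtration. -/

theorem basis_induction {ι R M : Type*} [Semiring R] [AddCommMonoid M] [Module R M]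
    (b : Module.Basis ι R M) {p : M → Prop} (zero : p 0) (add : ∀ x y, p x → p y → p (x + y))
    (smul : ∀ (a : R) i, p (a • b i)) (x : M) : p x := by
  rw [← b.linearCombination_repr x]
  induction b.repr x using Finsupp.induction_linear with
  | zero => simpa using zero
  | add f g hf hg => rw [map_add]; exact add _ _ hf hg
  | single i a => rw [Finsupp.linearCombination_single]; exact smul a i

namespace DGModule

variable {k : Type w} [Field k] {A : DGAlgebra.{w, u} k} {F : DGModule.{w, u, u} A}

theorem prev_le {fil : ℕ → Submodule A F} (h : Monotone fil) (i : ℕ) : prev fil i ≤ fil i := by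
  cases i with
  | zero => exact bot_le
  | succ i => exact h (Nat.le_succ i)

theorem SemiFreeFiltration.d_mem_prev (Φ : F.SemiFreeFiltration) {i : ℕ} {x : F}
    (hx : x ∈ prev Φ.fil i) : F.d x ∈ prev Φ.fil i := by
  cases i with
  | zero =>
    obtain rfl : x = 0 := hx
    rw [map_zero]
    exact zero_mem _
  | succ i => exact (Φ.isDGSubmodule i).d_mem x hx

theorem SemiFreeFiltration.prev_mono (Φ : F.SemiFreeFiltration) {i j : ℕ} (h : i ≤ j) :
    prev Φ.fil i ≤ prev Φ.fil j := by
  cases i with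
  | zero => exact bot_le
  | succ i =>
    cases j with
    | zero => lia
    | succ j => exact Φ.mono (Nat.succ_le_succ_iff.1 h)

/-- A basis of a semi-free DG module adapted to a semi-free filtration. -/
structure SemiFreeFiltration.LevelBasis (Φ : F.SemiFreeFiltration) where
  ι : ℕ → Type u
  deg : ∀ i, ι i → ℤ
  b : Module.Basis (Σ i, ι i) A F
  mem_gr : ∀ i l, b ⟨i, l⟩ ∈ F.gr (deg i l)
  d_mem : ∀ i l, F.d (b ⟨i, l⟩) ∈ prev Φ.fil i
  mem_fil_iff : ∀ i x, x ∈ Φ.fil i ↔ ∀ m, i < m → ∀ l, b.repr x ⟨m, l⟩ = 0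

/-- Each extension `F(i-1) ⊆ F(i)` splits over `A` because the quotient is free, so homogeneous
lifts of the bases of all quotients together form a basis of `F`. -/
theorem SemiFreeFiltration.nonempty_levelBasis (Φ : F.SemiFreeFiltration) :
    Nonempty Φ.LevelBasis := by
  classical
  choose ι deg e b hb using Φ.free
  let v : (Σ i, ι i) → F := fun x => e x.1 x.2
  let κ : ∀ i, ι i → Φ.fil i →ₗ[A] A := fun i l =>
    (b i).coord l ∘ₗ ((prev Φ.fil i).submoduleOf (Φ.fil i)).mkQ
  have hκe : ∀ i l l', κ i l (e i l') = if l' = l then 1 else 0 := by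
    intro i l l'
    change (b i).repr (Submodule.Quotient.mk (e i l')) l = _
    rw [← (hb i l').1, (b i).repr_self, Finsupp.single_apply]
  have hκp : ∀ i l (x : Φ.fil i), (x : F) ∈ prev Φ.fil i → κ i l x = 0 := by
    intro i l x hx
    change (b i).coord l (Submodule.Quotient.mk x) = 0
    rw [(Submodule.Quotient.mk_eq_zero _).2 (by exact hx), map_zero]
  have hli : LinearIndependent A v := by
    have key : ∀ n (s : Finset (Σ i, ι i)) (g : (Σ i, ι i) → A), (∀ x ∈ s, x.1 < n) →
        ∑ x ∈ s, g x • v x = 0 → ∀ x ∈ s, g x = 0 := by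
      intro n
      induction n with
      | zero => intro s g hs _ x hx; exact absurd (hs x hx) (Nat.not_lt_zero _)
      | succ n ih =>
        intro s g hs hsum
        -- The relation is moved into `F(n)` so that the coordinates on `F(n)/F(n-1)` apply; the
        -- default `0` is never met, since `s` has no index above level `n`.
        let V : (Σ i, ι i) → Φ.fil n := fun x =>
          if h : x.1 ≤ n then ⟨v x, Φ.mono h (e x.1 x.2).2⟩ else 0
        have hV : ∀ x ∈ s, (V x : F) = v x := by
          intro x hx
          simp only [V]
          rw [dif_pos (Nat.lt_succ_iff.1 (hs x hx))]
        have hVs : ∑ x ∈ s, g x • V x = 0 := by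
          apply Subtype.ext
          rw [Submodule.coe_sum, Submodule.coe_zero, ← hsum]
          exact Finset.sum_congr rfl fun x hx => by rw [Submodule.coe_smul, hV x hx]
        -- Modulo `F(n-1)` only the top-level terms survive, and those are independent.
        have htop : ∀ x ∈ s, x.1 = n → g x = 0 := by
          rintro ⟨m, l⟩ hx rfl
          have h := congrArg (κ m l) hVs
          rw [map_sum, map_zero, Finset.sum_eq_single_of_mem _ hx] at h
          · have h1 : V ⟨m, l⟩ = e m l := Subtype.ext (hV _ hx)
            rw [map_smul, h1, hκe, if_pos rfl] at h
            simpa using h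
          · rintro ⟨m', l'⟩ hy hne
            rw [map_smul]
            rcases Nat.lt_succ_iff_lt_or_eq.1 (hs _ hy) with hlt | heq
            · rw [hκp, smul_zero]
              rw [hV _ hy]
              cases m with
              | zero => exact absurd hlt (Nat.not_lt_zero _)
              | succ m => exact Φ.mono (Nat.lt_succ_iff.1 hlt) (e m' l').2
            · obtain rfl : m' = m := heq
              have h1 : V ⟨m', l'⟩ = e m' l' := Subtype.ext (hV _ hy)
              rw [h1, hκe, if_neg (fun h => hne (by rw [h])), smul_zero]
        have hsum' : ∑ x ∈ s.filter (fun x => x.1 < n), g x • v x = 0 := by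
          rw [← hsum]
          refine Finset.sum_subset (Finset.filter_subset _ _) fun x hx hx' => ?_
          rw [htop x hx, zero_smul]
          have := hs x hx
          simp only [Finset.mem_filter, hx, true_and] at hx'
          lia
        intro x hx
        rcases Nat.lt_succ_iff_lt_or_eq.1 (hs x hx) with hlt | heq
        · exact ih _ g (fun y hy => (Finset.mem_filter.1 hy).2) hsum' x
            (Finset.mem_filter.2 ⟨hx, hlt⟩)
        · exact htop x hx heq
    rw [linearIndependent_iff']
    intro s g hsum
    exact key (s.sup Sigma.fst + 1) s g (fun x hx => Nat.lt_succ_of_le (Finset.le_sup hx)) hsum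
  let S : ℕ → Submodule A F := fun i => Submodule.span A (v '' {x | x.1 ≤ i})
  have hSmono : Monotone S := fun i j hij =>
    Submodule.span_mono (Set.image_mono fun x (hx : x.1 ≤ i) => le_trans hx hij)
  have hle : ∀ i, Φ.fil i ≤ S i := by
    -- Expanding the class of `x` in the basis of the quotient gives a combination of lifts of level
    -- `i` that differs from `x` by an element of `F(i-1)`.
    have step : ∀ i, prev Φ.fil i ≤ S i → Φ.fil i ≤ S i := by
      intro i hp x hx
      let y := (b i).repr (Submodule.Quotient.mk ⟨x, hx⟩)
      have hy : Finsupp.linearCombination A (b i) y = Submodule.Quotient.mk ⟨x, hx⟩ :=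
        (b i).linearCombination_repr _
      have hy' : Submodule.Quotient.mk (Finsupp.linearCombination A (e i) y)
          = (Submodule.Quotient.mk ⟨x, hx⟩ :
            Φ.fil i ⧸ (prev Φ.fil i).submoduleOf (Φ.fil i)) := by
        rw [← hy]
        have : (b i : ι i → _) = ((prev Φ.fil i).submoduleOf (Φ.fil i)).mkQ ∘ e i :=
          funext fun l => (hb i l).1
        rw [this, ← Finsupp.apply_linearCombination]
        rfl
      have hd := (Submodule.Quotient.eq _).1 hy'
      have hd' : (Finsupp.linearCombination A (e i) y : F) - x ∈ prev Φ.fil i := hd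
      have hmem : (Finsupp.linearCombination A (e i) y : F) ∈ S i := by
        rw [Finsupp.linearCombination_apply, Finsupp.sum, Submodule.coe_sum]
        refine sum_mem fun l _ => ?_
        exact Submodule.smul_mem _ _ (Submodule.subset_span ⟨⟨i, l⟩, le_refl i, rfl⟩)
      have := sub_mem hmem (hp hd')
      rwa [sub_sub_cancel] at this
    intro i
    induction i with
    | zero => exact step 0 bot_le
    | succ i ih => exact step (i + 1) (ih.trans (hSmono (Nat.le_succ i)))
  have hge : ∀ i, S i ≤ Φ.fil i := by
    intro i
    refine Submodule.span_le.2 ?_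
    rintro _ ⟨x, hx, rfl⟩
    exact Φ.mono hx (e x.1 x.2).2
  have hsp : ⊤ ≤ Submodule.span A (Set.range v) := by
    intro x _
    obtain ⟨i, hi⟩ := Φ.exhaustive x
    exact Submodule.span_mono (Set.image_subset_range _ _) (hle i hi)
  let B := Module.Basis.mk hli hsp
  have hB : ⇑B = v := Module.Basis.coe_mk hli hsp
  refine ⟨⟨ι, deg, B, fun i l => ?_, fun i l => ?_, fun i x => ?_⟩⟩
  · rw [hB]; exact (hb i l).2.1
  · rw [hB]; exact (hb i l).2.2
  · rw [show x ∈ Φ.fil i ↔ x ∈ S i from ⟨fun h => hle i h, fun h => hge i h⟩]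
    simp only [S]
    rw [← hB, B.mem_span_image]
    constructor
    · intro h m hm l
      by_contra hne
      have : m ≤ i := h (Finsupp.mem_support_iff.2 hne)
      lia
    · rintro h ⟨m, l⟩ hx
      by_contra hlt
      exact Finsupp.mem_support_iff.1 hx (h m (not_le.1 hlt) l)

namespace SemiFreeFiltration.LevelBasis

variable {Φ : F.SemiFreeFiltration} (B : Φ.LevelBasis)

theorem mem_prev_iff (i : ℕ) (x : F) :
    x ∈ prev Φ.fil i ↔ ∀ m, i ≤ m → ∀ l, B.b.repr x ⟨m, l⟩ = 0 := by
  cases i with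
  | zero =>
    change x = 0 ↔ _
    constructor
    · rintro rfl m _ l
      simp
    · intro h
      refine B.b.repr.map_eq_zero_iff.1 (Finsupp.ext ?_)
      rintro ⟨m, l⟩
      exact h m (Nat.zero_le m) l
  | succ i => exact B.mem_fil_iff i x

theorem mem_fil (i : ℕ) (l : B.ι i) : B.b ⟨i, l⟩ ∈ Φ.fil i := by
  rw [B.mem_fil_iff]
  intro m hm l'
  rw [B.b.repr_self, Finsupp.single_eq_of_ne]
  intro h
  have := congrArg Sigma.fst h
  simp only at this
  lia

theorem mem_prev_of_lt {i j : ℕ} (h : i < j) (l : B.ι i) : B.b ⟨i, l⟩ ∈ prev Φ.fil j := by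
  cases j with
  | zero => lia
  | succ j => exact Φ.mono (Nat.lt_succ_iff.1 h) (B.mem_fil i l)

theorem repr_comp (j : ℤ) (x : F) (m : ℕ) (l : B.ι m) :
    B.b.repr (F.comp j x) ⟨m, l⟩
      = grComp A.isInternal (j - B.deg m l) (B.b.repr x ⟨m, l⟩) := by
  classical
  induction x using basis_induction B.b with
  | zero => simp
  | add x y hx hy => simp only [map_add, Finsupp.add_apply, hx, hy]
  | smul a y =>
    obtain ⟨m', l'⟩ := y
    rw [comp_smul a (B.mem_gr m' l'), map_smul, map_smul, B.b.repr_self]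
    by_cases h : (⟨m', l'⟩ : Σ i, B.ι i) = ⟨m, l⟩
    · cases h
      simp
    · simp [h]

theorem prev_induction {i : ℕ} {p : F → Prop} (zero : p 0)
    (add : ∀ x y, p x → p y → p (x + y))
    (smul : ∀ m, m < i → ∀ (l : B.ι m) (a : A), p (a • B.b ⟨m, l⟩)) {x : F}
    (hx : x ∈ prev Φ.fil i) : p x := by
  rw [B.mem_prev_iff] at hx
  rw [← B.b.linearCombination_repr x, Finsupp.linearCombination_apply, Finsupp.sum]
  refine Finset.sum_induction _ p add zero ?_
  rintro ⟨m, l⟩ hl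
  refine smul m ?_ l _
  by_contra hm
  exact Finsupp.mem_support_iff.1 hl (hx m (not_lt.1 hm) l)

end SemiFreeFiltration.LevelBasis

/-- The basis is homogeneous, so coordinates of a component are components of coordinates, and
vanishing above level `i` is inherited. -/
theorem SemiFreeFiltration.comp_mem_fil (Φ : F.SemiFreeFiltration) (j : ℤ) {i : ℕ} {x : F}
    (hx : x ∈ Φ.fil i) : F.comp j x ∈ Φ.fil i := by
  obtain ⟨B⟩ := Φ.nonempty_levelBasis
  rw [B.mem_fil_iff] at hx ⊢
  intro m hm l
  rw [B.repr_comp, hx m hm, map_zero]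

theorem comp_mem_prev {fil : ℕ → Submodule A F}
    (h : ∀ (j : ℤ) (i : ℕ) (x : F), x ∈ fil i → F.comp j x ∈ fil i) (j : ℤ) {i : ℕ} {x : F}
    (hx : x ∈ prev fil i) : F.comp j x ∈ prev fil i := by
  cases i with
  | zero =>
    obtain rfl : x = 0 := hx
    rw [map_zero]
    exact zero_mem _
  | succ i => exact h j i x hx

end DGModule

/-! ### Lifting up to homotopy, compatibly with filtrations. -/

namespace DGModule

variable {k : Type w} [Field k] {A : DGAlgebra.{w, u} k} {F G X Y M : DGModule.{w, u, u} A}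

/-- The stage `i` of the construction of a lift: a pair of linear maps that are a morphism `g` and
a homotopy `h` from `q g` to `η` on `G(i-1)`. -/
structure IsPartialLift (Φ : G.SemiFreeFiltration) (q : DGHom X Y) (η : DGHom G Y)
    (fX : ℕ → Submodule A X) (i : ℕ) (g : G →ₗ[A] X) (h : G →ₗ[A] Y) : Prop where
  comp_fst : ∀ x ∈ prev Φ.fil i, ∀ j, X.comp j (g x) = g (G.comp j x)
  comp_snd : ∀ x ∈ prev Φ.fil i, ∀ j, Y.comp (j - 1) (h x) = h (G.comp j x)
  map_d : ∀ x ∈ prev Φ.fil i, g (G.d x) = X.d (g x)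
  homotopy : ∀ x ∈ prev Φ.fil i, Y.d (h x) - h (G.d x) = Y.par (q.toFun (g x) - η.toFun x)
  map_prev : ∀ m ≤ i, ∀ x ∈ prev Φ.fil m, g x ∈ prev fX m

theorem comp_eq_self {j : ℤ} {x : X} (hx : x ∈ X.gr j) : X.comp j x = x :=
  grComp_same X.isInternal hx

theorem comp_mem (j : ℤ) (x : X) : X.comp j x ∈ X.gr j := grComp_mem X.isInternal j x

theorem mem_gr_of_comp_eq {j : ℤ} {x : X} (hx : X.comp j x = x) : x ∈ X.gr j :=
  hx ▸ comp_mem j x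

theorem par_mem {j : ℤ} {x : X} (hx : x ∈ X.gr j) : X.par x ∈ X.gr j := by
  have : X.par x = j.negOnePow • x := parity_of_mem X.isInternal hx
  rw [this, Units.smul_def]
  exact zsmul_mem hx _

section Lift

variable {Φ : G.SemiFreeFiltration} {q : DGHom X Y} {η : DGHom G Y} {fX : ℕ → Submodule A X}

/-- The values of the next stage of a lift on a basis element. -/
theorem IsPartialLift.exists_values (hmono : Monotone fX)
    (hcomp : ∀ (j : ℤ) (i : ℕ) (x : X), x ∈ fX i → X.comp j x ∈ fX i)
    (H1 : ∀ z, Y.d z = 0 → ∃ x ∈ fX 0, X.d x = 0 ∧ ∃ m, z = q.toFun x + Y.d m)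
    (H2 : ∀ i, ∀ c ∈ prev fX i, X.d c = 0 → (∃ m, q.toFun c = Y.d m) → ∃ y ∈ fX i, X.d y = c)
    {i : ℕ} {g : G →ₗ[A] X} {h : G →ₗ[A] Y} (P : IsPartialLift Φ q η fX i g h) {d : ℤ} {b : G}
    (hb : b ∈ G.gr d) (hdb : G.d b ∈ prev Φ.fil i) :
    ∃ y ∈ fX i, ∃ t : Y, y ∈ X.gr d ∧ t ∈ Y.gr (d - 1) ∧ X.d y = g (G.d b) ∧
      Y.d t - h (G.d b) = Y.par (q.toFun y - η.toFun b) := by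
  have hdb' : G.comp (d + 1) (G.d b) = G.d b := comp_eq_self (G.d_mem hb)
  have hc0 : X.d (g (G.d b)) = 0 := by rw [← P.map_d _ hdb, G.d_d, map_zero]
  have hqc : q.toFun (g (G.d b)) = Y.d (η.toFun b - Y.par (h (G.d b))) := by
    have h1 := congrArg Y.par (P.homotopy _ hdb)
    rw [G.d_d, map_zero, sub_zero, parity_parity, par_d] at h1
    rw [map_sub, ← η.map_d, sub_eq_add_neg, h1]
    abel
  -- First obstruction: `g (∂b)` is a cocycle whose image in `Y` bounds, so it bounds within the
  -- allowed filtration step.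
  obtain ⟨y₀, hy₀, hdy₀⟩ := H2 i _ (P.map_prev i le_rfl _ hdb) hc0 ⟨_, hqc⟩
  have hdy : X.d (X.comp d y₀) = g (G.d b) := by
    rw [← comp_d, hdy₀, P.comp_fst _ hdb, hdb']
  set y := X.comp d y₀ with hy
  have hhd : Y.comp d (h (G.d b)) = h (G.d b) := by
    have := P.comp_snd _ hdb (d + 1)
    rwa [hdb', add_sub_cancel_right] at this
  have hz0 : Y.d (q.toFun y - η.toFun b + Y.par (h (G.d b))) = 0 := by
    rw [map_add, map_sub, ← q.map_d, hdy, hqc, ← η.map_d, map_sub, ← η.map_d]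
    abel
  have hzd : q.toFun y - η.toFun b + Y.par (h (G.d b)) ∈ Y.gr d :=
    add_mem (sub_mem (q.map_gr (comp_mem d y₀)) (η.map_gr hb))
      (par_mem (mem_gr_of_comp_eq hhd))
  -- Second obstruction: the failure of the homotopy identity at `b` is a cocycle of `Y`.
  -- Subtracting the cocycle `w` from `y` turns it into a coboundary, and `m` supplies the value of
  -- the homotopy.
  obtain ⟨w, hw, hdw, m, hm⟩ := H1 _ hz0
  have hm' : q.toFun y - η.toFun b + Y.par (h (G.d b))
      = q.toFun (X.comp d w) + Y.d (Y.comp (d - 1) m) := by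
    rw [← comp_eq_self hzd, hm, map_add, ← q.map_comp, ← comp_d, sub_add_cancel]
  refine ⟨y - X.comp d w, sub_mem (hcomp d i _ hy₀) (hmono (Nat.zero_le i) (hcomp d 0 _ hw)),
    -Y.par (Y.comp (d - 1) m), sub_mem (comp_mem _ _) (comp_mem _ _),
    neg_mem (par_mem (comp_mem _ _)), ?_, ?_⟩
  · rw [map_sub, hdy, ← comp_d, hdw, map_zero, sub_zero]
  · have h1 : q.toFun (y - X.comp d w) - η.toFun b
        = Y.d (Y.comp (d - 1) m) - Y.par (h (G.d b)) := by
      rw [map_sub, sub_right_comm, eq_sub_of_add_eq hm']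
      abel
    rw [h1, map_sub, parity_parity, par_d, map_neg]

/-- `exists_values` chooses the images of the level-`i` basis vectors one at a time, and freeness
extends them linearly. All identities are then checked on `F(i-1)` and on multiples of the new
vectors. -/
theorem IsPartialLift.exists_succ (hmono : Monotone fX)
    (hcomp : ∀ (j : ℤ) (i : ℕ) (x : X), x ∈ fX i → X.comp j x ∈ fX i)
    (H1 : ∀ z, Y.d z = 0 → ∃ x ∈ fX 0, X.d x = 0 ∧ ∃ m, z = q.toFun x + Y.d m)
    (H2 : ∀ i, ∀ c ∈ prev fX i, X.d c = 0 → (∃ m, q.toFun c = Y.d m) → ∃ y ∈ fX i, X.d y = c)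
    {i : ℕ} {g : G →ₗ[A] X} {h : G →ₗ[A] Y} (P : IsPartialLift Φ q η fX i g h) :
    ∃ (g' : G →ₗ[A] X) (h' : G →ₗ[A] Y), IsPartialLift Φ q η fX (i + 1) g' h' ∧
      ∀ x ∈ prev Φ.fil i, g' x = g x ∧ h' x = h x := by
  classical
  obtain ⟨B⟩ := Φ.nonempty_levelBasis
  choose y hy t hyd htd hdy hdt using fun l : B.ι i =>
    P.exists_values hmono hcomp H1 H2 (B.mem_gr i l) (B.d_mem i l)
  -- Only level `i` receives new values; those above it are arbitrary at this stage.
  let g' : G →ₗ[A] X := B.b.constr ℕ fun x =>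
    if e : x.1 = i then y (e ▸ x.2) else g (B.b x)
  let h' : G →ₗ[A] Y := B.b.constr ℕ fun x =>
    if e : x.1 = i then t (e ▸ x.2) else h (B.b x)
  have hg'i : ∀ l, g' (B.b ⟨i, l⟩) = y l := by
    intro l
    simp [g', Module.Basis.constr_basis]
  have hh'i : ∀ l, h' (B.b ⟨i, l⟩) = t l := by
    intro l
    simp [h', Module.Basis.constr_basis]
  have hg'ne : ∀ m, m ≠ i → ∀ l, g' (B.b ⟨m, l⟩) = g (B.b ⟨m, l⟩) := by
    intro m hm l
    simp [g', Module.Basis.constr_basis, hm]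
  have hh'ne : ∀ m, m ≠ i → ∀ l, h' (B.b ⟨m, l⟩) = h (B.b ⟨m, l⟩) := by
    intro m hm l
    simp [h', Module.Basis.constr_basis, hm]
  have agree : ∀ x ∈ prev Φ.fil i, g' x = g x ∧ h' x = h x := by
    intro x hx
    refine B.prev_induction (p := fun x => g' x = g x ∧ h' x = h x) (by simp) ?_ ?_ hx
    · rintro x y ⟨hx, hx'⟩ ⟨hy, hy'⟩
      simp only [map_add, hx, hx', hy, hy', and_self]
    · intro m hm l a
      simp only [map_smul, hg'ne m hm.ne, hh'ne m hm.ne, and_self]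
  have step : ∀ {p : G → Prop}, p 0 → (∀ x y, p x → p y → p (x + y)) →
      (∀ x ∈ prev Φ.fil i, p x) → (∀ l (a : A), p (a • B.b ⟨i, l⟩)) →
      ∀ x ∈ prev Φ.fil (i + 1), p x := by
    intro p h0 hadd hp hl x hx
    refine B.prev_induction h0 hadd (fun m hm l a => ?_) hx
    rcases Nat.lt_succ_iff_lt_or_eq.1 hm with hlt | rfl
    · exact hp _ (Submodule.smul_mem _ a (B.mem_prev_of_lt hlt l))
    · exact hl l a
  have hcG : ∀ (j : ℤ) x, x ∈ prev Φ.fil i → G.comp j x ∈ prev Φ.fil i := fun j x hx =>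
    comp_mem_prev (fun j i x hx => Φ.comp_mem_fil j hx) j hx
  refine ⟨g', h', ⟨?_, ?_, ?_, ?_, ?_⟩, agree⟩
  · refine step (by simp) (fun x y hx hy j => by simp only [map_add, hx, hy])
      (fun x hx j => ?_) fun l a j => ?_
    · rw [(agree x hx).1, (agree _ (hcG j x hx)).1, P.comp_fst x hx]
    · rw [map_smul, hg'i, comp_smul a (hyd l), comp_smul a (B.mem_gr i l), map_smul, hg'i]
  · refine step (by simp) (fun x y hx hy j => by simp only [map_add, hx, hy])
      (fun x hx j => ?_) fun l a j => ?_
    · rw [(agree x hx).2, (agree _ (hcG j x hx)).2, P.comp_snd x hx]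
    · rw [map_smul, hh'i, comp_smul a (htd l), comp_smul a (B.mem_gr i l), map_smul, hh'i,
        sub_sub_sub_cancel_right]
  · refine step (by simp) (fun x y hx hy => by simp only [map_add, hx, hy])
      (fun x hx => ?_) fun l a => ?_
    · rw [(agree x hx).1, (agree _ (Φ.d_mem_prev hx)).1, P.map_d x hx]
    · rw [d_smul, map_add, map_smul, map_smul, map_smul, d_smul, hg'i,
        (agree _ (B.d_mem i l)).1, hdy]
  · refine step (by simp) (fun x y hx hy => ?_) (fun x hx => ?_) fun l a => ?_
    · simp only [map_add]
      rw [add_sub_add_comm, hx, hy, ← map_add]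
      congr 1
      abel
    · rw [(agree x hx).1, (agree x hx).2, (agree _ (Φ.d_mem_prev hx)).2, P.homotopy x hx]
    -- A degree `-1` homotopy is usually linear only up to sign. Twisting by parity makes `h`
    -- honestly `A`-linear: the terms with `∂a` cancel and both sides are multiplied by `A.par a`.
    · have h1 : q.toFun (g' (a • B.b ⟨i, l⟩)) - η.toFun (a • B.b ⟨i, l⟩)
          = a • (q.toFun (y l) - η.toFun (B.b ⟨i, l⟩)) := by
        rw [map_smul, map_smul, map_smul, hg'i, smul_sub]
      rw [h1, par_smul, ← hdt, h'.map_smul, hh'i, d_smul, d_smul, h'.map_add, h'.map_smul,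
        h'.map_smul, hh'i, (agree _ (B.d_mem i l)).2, smul_sub]
      abel
  · intro m hm x hx
    rcases Nat.le_succ_iff.1 hm with hle | rfl
    · rw [(agree x (Φ.prev_mono hle hx)).1]
      exact P.map_prev m hle x hx
    · refine step (p := fun x => g' x ∈ prev fX (i + 1)) (by simp)
        (fun x y hx hy => by rw [map_add]; exact add_mem hx hy) (fun x hx => ?_)
        (fun l a => ?_) x hx
      · rw [(agree x hx).1]
        exact prev_le hmono i (P.map_prev i le_rfl x hx)
      · rw [map_smul, hg'i]
        exact Submodule.smul_mem _ a (hy l)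

/-- Lifting of a morphism from a semi-free DG module along `q : X → Y`, up to homotopy and
compatibly with a filtration of `X`. -/
theorem exists_filtered_lift (Φ : G.SemiFreeFiltration) (q : DGHom X Y) (η : DGHom G Y)
    (fX : ℕ → Submodule A X) (hmono : Monotone fX)
    (hcomp : ∀ (j : ℤ) (i : ℕ) (x : X), x ∈ fX i → X.comp j x ∈ fX i)
    (H1 : ∀ z, Y.d z = 0 → ∃ x ∈ fX 0, X.d x = 0 ∧ ∃ m, z = q.toFun x + Y.d m)
    (H2 : ∀ i, ∀ c ∈ prev fX i, X.d c = 0 → (∃ m, q.toFun c = Y.d m) →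
      ∃ y ∈ fX i, X.d y = c) :
    ∃ (g : DGHom G X) (h : G →ₗ[A] Y),
      (∀ x, Y.d (h x) - h (G.d x) = Y.par (q.toFun (g.toFun x) - η.toFun x)) ∧
      ∀ i, ∀ x ∈ Φ.fil i, g.toFun x ∈ fX i := by
  obtain ⟨B⟩ := Φ.nonempty_levelBasis
  let T : ℕ → Type u := fun i =>
    {p : (G →ₗ[A] X) × (G →ₗ[A] Y) // IsPartialLift Φ q η fX i p.1 p.2}
  have base : IsPartialLift Φ q η fX 0 0 0 := by
    refine ⟨?_, ?_, ?_, ?_, ?_⟩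
    · intro x _ j; simp
    · intro x _ j; simp
    · intro x _; simp
    · intro x hx
      obtain rfl : x = 0 := hx
      simp
    · intro m _ x _
      exact zero_mem _
  have hstep : ∀ i (p : T i), ∃ p' : T (i + 1), ∀ x ∈ prev Φ.fil i,
      p'.1.1 x = p.1.1 x ∧ p'.1.2 x = p.1.2 x := by
    intro i p
    obtain ⟨g', h', P, hag⟩ := p.2.exists_succ hmono hcomp H1 H2
    exact ⟨⟨(g', h'), P⟩, hag⟩
  choose next hnext using hstep
  let s : ∀ i, T i := fun i => Nat.rec (motive := T) ⟨(0, 0), base⟩ next i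
  have hs : ∀ i, ∀ x ∈ prev Φ.fil i,
      (s (i + 1)).1.1 x = (s i).1.1 x ∧ (s (i + 1)).1.2 x = (s i).1.2 x :=
    fun i => hnext i (s i)
  have hs' : ∀ i j, i ≤ j → ∀ x ∈ prev Φ.fil i,
      (s j).1.1 x = (s i).1.1 x ∧ (s j).1.2 x = (s i).1.2 x := by
    intro i j hij x hx
    induction j, hij using Nat.le_induction with
    | base => exact ⟨rfl, rfl⟩
    | succ j hij ih =>
      have := hs j x (Φ.prev_mono hij hx)
      rwa [this.1, this.2]
  -- Stage `m + 1` is the first that controls `F(m)`, hence the basis vectors of level `m`; later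
  -- stages do not change it there.
  let g : G →ₗ[A] X := B.b.constr ℕ fun x => (s (x.1 + 1)).1.1 (B.b x)
  let h : G →ₗ[A] Y := B.b.constr ℕ fun x => (s (x.1 + 1)).1.2 (B.b x)
  have hgs : ∀ i, ∀ x ∈ prev Φ.fil i, g x = (s i).1.1 x ∧ h x = (s i).1.2 x := by
    intro i x hx
    refine B.prev_induction (p := fun x => g x = (s i).1.1 x ∧ h x = (s i).1.2 x) (by simp)
      ?_ ?_ hx
    · rintro x y ⟨hx, hx'⟩ ⟨hy, hy'⟩
      simp only [map_add, hx, hx', hy, hy', and_self]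
    · intro m hm l a
      have := hs' (m + 1) i hm _ (B.mem_fil m l)
      simp only [map_smul, g, h, Module.Basis.constr_basis, this.1, this.2, and_self]
  have hex : ∀ x : G, ∃ i, x ∈ prev Φ.fil i := fun x => by
    obtain ⟨i, hi⟩ := Φ.exhaustive x
    exact ⟨i + 1, hi⟩
  have hcG : ∀ (j : ℤ) i x, x ∈ prev Φ.fil i → G.comp j x ∈ prev Φ.fil i := fun j i x hx =>
    comp_mem_prev (fun j i x hx => Φ.comp_mem_fil j hx) j hx
  refine ⟨⟨g, ?_, ?_⟩, h, ?_, ?_⟩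
  · intro j x hx
    obtain ⟨i, hi⟩ := hex x
    apply mem_gr_of_comp_eq
    rw [(hgs i x hi).1, (s i).2.comp_fst x hi, comp_eq_self hx]
  · intro x
    obtain ⟨i, hi⟩ := hex x
    rw [(hgs i x hi).1, (hgs i _ (Φ.d_mem_prev hi)).1, (s i).2.map_d x hi]
  · intro x
    obtain ⟨i, hi⟩ := hex x
    change Y.d (h x) - h (G.d x) = Y.par (q.toFun (g x) - η.toFun x)
    rw [(hgs i x hi).1, (hgs i x hi).2, (hgs i _ (Φ.d_mem_prev hi)).2, (s i).2.homotopy x hi]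
  · intro i x hx
    change g x ∈ fX i
    rw [(hgs (i + 1) x hx).1]
    exact (s (i + 1)).2.map_prev (i + 1) le_rfl x hx

/-- Lifting of a morphism from a semi-free DG module along a quasi-isomorphism, up to
homotopy. -/
theorem exists_lift (Φ : G.SemiFreeFiltration) {q : DGHom X Y} (hq : q.IsQuasiIso)
    (η : DGHom G Y) : ∃ (g : DGHom G X) (h : G →ₗ[A] Y),
      ∀ x, Y.d (h x) - h (G.d x) = Y.par (q.toFun (g.toFun x) - η.toFun x) := by
  rw [DGHom.isQuasiIso_iff] at hq
  obtain ⟨g, h, hgh, _⟩ := exists_filtered_lift Φ q η (fun _ => ⊤) monotone_const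
    (fun _ _ _ _ => trivial)
    (fun z hz => by
      obtain ⟨x, hx, m, hm⟩ := hq.1 z hz
      exact ⟨x, trivial, hx, m, hm⟩)
    (fun i c _ hc hm => by
      obtain ⟨y, hy⟩ := hq.2 c hc hm
      exact ⟨y, trivial, hy⟩)
  exact ⟨g, h, hgh⟩

end Lift

end DGModule

/-! ### Levels of a minimal Eilenberg–Moore resolution against other resolutions. -/

namespace DGModule

variable {k : Type w} [Field k] {A : DGAlgebra.{w, u} k} {F G X Y M : DGModule.{w, u, u} A}

/-- Homotopic morphisms agree on cocycles up to coboundaries. -/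
theorem exists_d_eq_of_homotopy {f f' : X → Y} {h : X →ₗ[A] Y}
    (H : ∀ x, Y.d (h x) - h (X.d x) = Y.par (f x - f' x)) {x : X} (hx : X.d x = 0) :
    ∃ m, f x = f' x + Y.d m := by
  have h1 := congrArg Y.par (H x)
  rw [hx, map_zero, sub_zero, parity_parity, par_d] at h1
  refine ⟨-Y.par (h x), ?_⟩
  rw [map_neg, h1]
  abel

theorem SemiFreeFiltration.E1Exact.exists_cocycle {Φ : F.SemiFreeFiltration} {ε : DGHom F M}
    (hE : Φ.E1Exact ε) {z : M} (hz : M.d z = 0) :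
    ∃ x ∈ Φ.fil 0, F.d x = 0 ∧ ∃ m, z = ε.toFun x + M.d m := by
  let z' : M.cocycles := ⟨z, hz⟩
  obtain ⟨y, hy⟩ := hE.surjective_aug (M.cls z')
  obtain ⟨x, rfl⟩ := QuotientAddGroup.mk_surjective y
  have h0 : M.cls (Φ.augRep ε x) = M.cls z' := hy
  have h1 : M.cls (z' - Φ.augRep ε x) = 0 := by
    rw [map_sub, h0, sub_self]
  obtain ⟨m, hm⟩ := (M.cls_eq_zero_iff _).1 h1
  refine ⟨x, x.2.1, x.2.2, m, ?_⟩
  rw [hm]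
  exact (add_sub_cancel (ε.toFun x) z).symm

/-- In an Eilenberg–Moore resolution, a cocycle of `F(i-1)` that is a coboundary of `F` is a
coboundary of `F(i)`. -/
theorem SemiFreeFiltration.E1Exact.exists_d_eq {Φ : F.SemiFreeFiltration} {ε : DGHom F M}
    (hE : Φ.E1Exact ε) (i : ℕ) :
    ∀ c ∈ prev Φ.fil i, F.d c = 0 → (∃ y, F.d y = c) → ∃ y ∈ Φ.fil i, F.d y = c := by
  induction i with
  | zero =>
    intro c hc _ _
    obtain rfl : c = 0 := hc
    exact ⟨0, zero_mem _, map_zero _⟩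
  | succ i ih =>
    intro c hc hdc hcy
    cases i with
    | zero =>
      let c' : Φ.relCocycles 0 := ⟨c, hc, by rw [hdc]; exact zero_mem _⟩
      have haug : Φ.aug ε (QuotientAddGroup.mk c') = 0 := by
        obtain ⟨y, rfl⟩ := hcy
        exact (M.cls_eq_zero_iff (Φ.augRep ε c')).2 ⟨ε.toFun y, (ε.map_d y).symm⟩
      obtain ⟨x', hx'⟩ := (hE.exact_zero _).1 haug
      obtain ⟨x, rfl⟩ := QuotientAddGroup.mk_surjective x'
      have h1 : -Φ.d1Rep 0 x + c' ∈ (Φ.relCoboundaries 0).addSubgroupOf (Φ.relCocycles 0) :=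
        QuotientAddGroup.eq.1 hx'
      obtain ⟨u, hu, _, ⟨t, ht, rfl⟩, hut⟩ := AddSubgroup.mem_sup.1
        (AddSubgroup.mem_addSubgroupOf.1 h1)
      obtain rfl : u = 0 := hu
      replace hut : 0 + F.d t = -F.d (x : F) + c := hut
      refine ⟨x + t, add_mem x.2.1 (Φ.mono (Nat.zero_le _) ht), ?_⟩
      rw [map_add, ← zero_add (F.d t), hut]
      abel
    | succ i =>
      let c' : Φ.relCocycles (i + 1) := ⟨c, hc, by rw [hdc]; exact zero_mem _⟩
      have hd1 : Φ.d1 i (QuotientAddGroup.mk c') = 0 := by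
        have : Φ.d1Rep i c' = 0 := Subtype.ext hdc
        change QuotientAddGroup.mk (Φ.d1Rep i c') = _
        rw [this]
        rfl
      obtain ⟨x', hx'⟩ := (hE.exact_succ i _).1 hd1
      obtain ⟨x, rfl⟩ := QuotientAddGroup.mk_surjective x'
      have h1 : -Φ.d1Rep (i + 1) x + c' ∈
          (Φ.relCoboundaries (i + 1)).addSubgroupOf (Φ.relCocycles (i + 1)) :=
        QuotientAddGroup.eq.1 hx'
      obtain ⟨u, hu, _, ⟨t, ht, rfl⟩, hut⟩ := AddSubgroup.mem_sup.1
        (AddSubgroup.mem_addSubgroupOf.1 h1)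
      replace hut : u + F.d t = -F.d (x : F) + c := hut
      have hu' : u = -F.d (x : F) + c - F.d t := eq_sub_of_add_eq hut
      obtain ⟨y, hy⟩ := hcy
      -- Exactness at the class of `c` gives `c = ∂x + u + ∂t` with `u` one step lower. As `c`
      -- bounds in `F`, so does `u`, and induction bounds it inside the filtration.
      obtain ⟨y', hy', hdy'⟩ := ih u hu
        (by rw [hu', map_sub, map_add, map_neg, F.d_d, F.d_d, hdc]; simp)
        ⟨-(x : F) + y - t, by rw [hu', map_sub, map_add, map_neg, hy]⟩
      refine ⟨x + t + y', add_mem (add_mem x.2.1 (Φ.mono (Nat.le_succ _) ht))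
        (Φ.mono (Nat.le_succ _) hy'), ?_⟩
      rw [map_add, map_add, hdy', hu']
      abel

theorem map_maximalIdealSMul (s : X →ₗ[A] Y) {x : X} (hx : x ∈ X.maximalIdealSMul) :
    s x ∈ Y.maximalIdealSMul := by
  induction hx using Submodule.span_induction with
  | mem x hx =>
    obtain ⟨i, hi, a, ha, y, rfl⟩ := hx
    rw [map_smul]
    exact Submodule.subset_span ⟨i, hi, a, ha, _, rfl⟩
  | zero => rw [map_zero]; exact zero_mem _
  | add x y _ _ hx hy => rw [map_add]; exact add_mem hx hy
  | smul a x _ hx => rw [map_smul]; exact Submodule.smul_mem _ a hx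

/-- The coordinates of an element of `𝔪 F` have no component in degree `0`. -/
theorem grComp_zero_repr (hA : A.IsConnected) {ι : Type*} (b : Module.Basis ι A F) {x : F}
    (hx : x ∈ F.maximalIdealSMul) (j : ι) : grComp A.isInternal 0 (b.repr x j) = 0 := by
  induction hx using Submodule.span_induction with
  | mem x hx =>
    obtain ⟨i, hi, a, ha, y, rfl⟩ := hx
    rw [map_smul, Finsupp.smul_apply, smul_eq_mul, DGAlgebra.grComp_zero_mul hA,
      grComp_ne A.isInternal (show a ∈ A.grAdd i from ha) hi.ne', zero_mul]
  | zero => simp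
  | add x y _ _ hx hy => simp only [map_add, Finsupp.add_apply, hx, hy, add_zero]
  | smul a x _ hx =>
    rw [map_smul, Finsupp.smul_apply, smul_eq_mul, DGAlgebra.grComp_zero_mul hA, hx, mul_zero]

/-- The levels of a minimal Eilenberg–Moore resolution of `M` are bounded by the length of any
semi-free resolution of `M`. -/
theorem isEmpty_of_isSemiFreeResolution (hA : A.IsConnected) {Φ : F.SemiFreeFiltration}
    (B : Φ.LevelBasis) {ε : DGHom F M} (hε : ε.IsQuasiIso) (hE : Φ.E1Exact ε)
    (hmin : F.IsMinimal) {η : DGHom G M} (hη : η.IsQuasiIso) (Ψ : G.SemiFreeFiltration) {n : ℕ}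
    (hn : Ψ.fil n = ⊤) (m : ℕ) (hm : n < m) : IsEmpty (B.ι m) := by
  obtain ⟨f, h₁, hf⟩ := exists_lift Φ hη ε
  rw [DGHom.isQuasiIso_iff] at hε hη
  have hf' : ∀ x, F.d x = 0 → ∃ m, η.toFun (f.toFun x) = ε.toFun x + M.d m := fun x hx =>
    exists_d_eq_of_homotopy (f := fun x => η.toFun (f.toFun x)) (f' := ε.toFun) hf hx
  -- Surjectivity of the augmentation puts a representative in `F(0)`, which lets lifts along `f`
  -- respect the filtration.
  have hfsurj : ∀ z, G.d z = 0 → ∃ x ∈ Φ.fil 0, F.d x = 0 ∧ ∃ m, z = f.toFun x + G.d m := by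
    intro z hz
    obtain ⟨x, hx, hdx, m, hm⟩ := hE.exists_cocycle (z := η.toFun z)
      (by rw [← η.map_d, hz, map_zero])
    obtain ⟨m', hm'⟩ := hf' x hdx
    obtain ⟨y, hy⟩ := hη.2 (z - f.toFun x) (by rw [map_sub, hz, ← f.map_d, hdx]; simp)
      ⟨m - m', by rw [map_sub, hm, hm', map_sub]; abel⟩
    exact ⟨x, hx, hdx, y, by rw [hy]; abel⟩
  have hfinj : ∀ c, F.d c = 0 → (∃ m, f.toFun c = G.d m) → ∃ y, F.d y = c := by
    rintro c hc ⟨m, hm⟩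
    obtain ⟨m', hm'⟩ := hf' c hc
    refine hε.2 c hc ⟨η.toFun m - m', ?_⟩
    rw [map_sub, ← η.map_d, ← hm, hm']
    abel
  obtain ⟨g, h₂, hg, hgfil⟩ := exists_filtered_lift Ψ f
    ⟨LinearMap.id, fun hx => hx, fun _ => rfl⟩ Φ.fil Φ.mono
    (fun j i x hx => Φ.comp_mem_fil j hx) hfsurj
    (fun i c hci hc hm => hE.exists_d_eq i c hci hc (hfinj c hc hm))
  have hg' : ∀ x, G.d x = 0 → ∃ m, f.toFun (g.toFun x) = x + G.d m := fun x hx =>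
    exists_d_eq_of_homotopy (f := fun x => f.toFun (g.toFun x)) (f' := fun x => x) hg hx
  have hgq : g.IsQuasiIso := by
    rw [DGHom.isQuasiIso_iff]
    refine ⟨fun z hz => ?_, fun c hc ⟨m, hm⟩ => ?_⟩
    · have hfz : G.d (f.toFun z) = 0 := by rw [← f.map_d, hz, map_zero]
      obtain ⟨m, hm⟩ := hg' _ hfz
      obtain ⟨y, hy⟩ := hfinj (z - g.toFun (f.toFun z))
        (by rw [map_sub, hz, ← g.map_d, hfz]; simp)
        ⟨-m, by rw [map_sub, hm, map_neg]; abel⟩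
      exact ⟨f.toFun z, hfz, y, by rw [hy]; abel⟩
    · obtain ⟨m', hm'⟩ := hg' c hc
      exact ⟨f.toFun m - m', by rw [map_sub, ← f.map_d, ← hm, hm']; abel⟩
  -- Lifting the identity of `F` along `g` gives `g f' ≃ id` with an `A`-linear `s`, so by
  -- minimality `∂s - s∂` takes values in `𝔪F`.
  obtain ⟨f', s, hs⟩ := exists_lift Φ hgq ⟨LinearMap.id, fun hx => hx, fun _ => rfl⟩
  refine ⟨fun l => ?_⟩
  have hfil : ∀ y, g.toFun y ∈ Φ.fil n := fun y => hgfil n y (by rw [hn]; trivial)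
  have hmem : F.d (s (B.b ⟨m, l⟩)) - s (F.d (B.b ⟨m, l⟩)) ∈ F.maximalIdealSMul :=
    sub_mem (hmin _) (map_maximalIdealSMul s (hmin _))
  have h0 := grComp_zero_repr hA B.b hmem ⟨m, l⟩
  have hpar : F.par (B.b ⟨m, l⟩) = (B.deg m l).negOnePow • B.b ⟨m, l⟩ :=
    parity_of_mem F.isInternal (B.mem_gr m l)
  -- The image of `g` lies in `F(n)`, so the coordinate at level `m > n` only sees the identity,
  -- contributing `±1` in degree zero.
  have hz := (B.mem_fil_iff n _).1 (hfil (G.par (f'.toFun (B.b ⟨m, l⟩)))) m hm l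
  rw [hs, map_sub, ← g.map_par, map_sub, Finsupp.sub_apply, hz, zero_sub] at h0
  change grComp A.isInternal 0 (-B.b.repr (F.par (B.b ⟨m, l⟩)) ⟨m, l⟩) = 0 at h0
  rw [hpar, Units.smul_def, map_zsmul, B.b.repr_self, Finsupp.smul_apply,
    Finsupp.single_eq_same, map_neg, map_zsmul, neg_eq_zero,
    grComp_same A.isInternal (show (1 : A) ∈ A.grAdd 0 from A.one_mem)] at h0
  have := hA.nontrivial
  rcases Int.units_eq_one_or (B.deg m l).negOnePow with h | h <;> rw [h] at h0 <;> simp at h0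

end DGModule

/-! ### Graded free modules over `H(A)`. -/

namespace DGAlgebra

variable {k : Type w} [Field k] (A : DGAlgebra.{w, u} k)

/-- The class of a cocycle of a DG algebra. -/
abbrev cls : A.cocycles →+* A.H := Ideal.Quotient.mk A.coboundaries

theorem HGr_isInternal : DirectSum.IsInternal A.HGr := by
  have hq : Function.Surjective A.cls := Ideal.Quotient.mk_surjective
  have hk : ∀ z : A.cocycles, A.cls z = 0 ↔ ∃ y, A.d.toAddMonoidHom y = z :=
    fun _ => Ideal.Quotient.eq_zero_iff_mem
  exact cohomology_isInternal A.isInternal A.d.toAddMonoidHom (fun _ _ hx => A.d_mem hx)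
    A.cocycles.toSubring.toAddSubgroup (fun _ => Iff.rfl) A.cls.toAddMonoidHom hq hk

noncomputable instance (ι : Type u) : Module A.H (ι →₀ A.H) := Finsupp.module ι A.H

noncomputable instance (ι : Type u) : SMul A.H (ι →₀ A.H) := Module.toDistribMulAction.toSMul

variable {A}

theorem cls_mem_HGr {i : ℤ} {a : A.cocycles} (ha : (a : A) ∈ A.gr i) : A.cls a ∈ A.HGr i :=
  ⟨a, ha, rfl⟩

theorem mul_mem_HGr {i j : ℤ} {x y : A.H} (hx : x ∈ A.HGr i) (hy : y ∈ A.HGr j) :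
    x * y ∈ A.HGr (i + j) := by
  obtain ⟨a, ha, rfl⟩ := hx
  obtain ⟨b, hb, rfl⟩ := hy
  exact ⟨(show A.cocycles from a) * (show A.cocycles from b), A.mul_mem ha hb, rfl⟩

theorem cls_eq_zero_iff (a : A.cocycles) : A.cls a = 0 ↔ ∃ y : A, A.d y = a :=
  Ideal.Quotient.eq_zero_iff_mem

end DGAlgebra

section FreeGraded

variable {R : Type u} [Ring R] {𝓡 : ℤ → AddSubgroup R}

theorem exists_sum_grComp_of_subset {X : Type u} [AddCommGroup X] {G : ℤ → AddSubgroup X}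
    (h : DirectSum.IsInternal G) (x : X) :
    ∃ s : Finset ℤ, ∀ t, s ⊆ t → ∑ i ∈ t, grComp h i x = x := by
  obtain ⟨s, hs⟩ := exists_sum_grComp h x
  refine ⟨s, fun t hst => ?_⟩
  rw [← Finset.sum_subset hst, hs]
  intro j _ hj
  rw [← hs, map_sum]
  exact Finset.sum_eq_zero fun i hi => grComp_ne h (grComp_mem h i x) fun e => hj (e ▸ hi)

/-- The grading of a free module on a family of generators of given degrees. -/
def freeGr (𝓡 : ℤ → AddSubgroup R) {ι : Type u} (deg : ι → ℤ) (m : ℤ) : AddSubgroup (ι →₀ R) where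
  carrier := {q | ∀ l, q l ∈ 𝓡 (m - deg l)}
  add_mem' hp hq l := add_mem (hp l) (hq l)
  zero_mem' _ := zero_mem _
  neg_mem' hp l := neg_mem (hp l)

theorem freeGr_isInternal (h : DirectSum.IsInternal 𝓡) {ι : Type u} (deg : ι → ℤ) :
    DirectSum.IsInternal (freeGr 𝓡 deg) := by
  classical
  let c : ℤ → (ι →₀ R) →+ (ι →₀ R) := fun m => AddMonoidHom.mk'
    (fun q => Finsupp.onFinset q.support (fun l => grComp h (m - deg l) (q l)) (by
      intro l hl
      rw [Finsupp.mem_support_iff]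
      rintro h0
      rw [h0, map_zero] at hl
      exact hl rfl)) (by intro p q; ext l; simp)
  have hc : ∀ m q l, c m q l = grComp h (m - deg l) (q l) := fun _ _ _ => rfl
  refine isInternal_of_components c (fun m q l => ?_) (fun m q hq => ?_)
    (fun m m' q hq hne => ?_) fun q => ?_
  · rw [hc]; exact grComp_mem h _ _
  · ext l; rw [hc, grComp_same h (hq l)]
  · ext l; rw [hc, grComp_ne h (hq l) (by lia)]; rfl
  -- The statement is strengthened to all larger index sets so that the witnesses for two summands
  -- can be united.
  · suffices H : ∃ s : Finset ℤ, ∀ t, s ⊆ t → ∑ i ∈ t, c i q = q by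
      obtain ⟨s, hs⟩ := H
      exact ⟨s, hs s subset_rfl⟩
    induction q using Finsupp.induction_linear with
    | zero => exact ⟨∅, fun t _ => by simp⟩
    | add p q hp hq =>
      obtain ⟨s, hs⟩ := hp
      obtain ⟨s', hs'⟩ := hq
      refine ⟨s ∪ s', fun t ht => ?_⟩
      simp only [map_add, Finset.sum_add_distrib]
      rw [hs t (Finset.union_subset_left ht), hs' t (Finset.union_subset_right ht)]
    | single l a =>
      obtain ⟨s, hs⟩ := exists_sum_grComp_of_subset h a
      refine ⟨s.map (Equiv.addRight (deg l)).toEmbedding, fun t ht => ?_⟩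
      ext l'
      rw [Finsupp.finsetSum_apply]
      simp only [hc]
      by_cases hl : l = l'
      · subst hl
        rw [Finsupp.single_eq_same]
        have := hs (t.map (Equiv.subRight (deg l)).toEmbedding) (by
          intro i hi
          have := ht (Finset.mem_map_of_mem _ hi)
          rw [Finset.mem_map]
          exact ⟨_, this, by simp⟩)
        rw [Finset.sum_map] at this
        simpa using this
      · rw [Finsupp.single_eq_of_ne (Ne.symm hl)]
        simp

/-- The graded free module on a family of generators of given degrees. -/
noncomputable def GrMod.free (h : DirectSum.IsInternal 𝓡)
    (hmul : ∀ {i j : ℤ} {x y : R}, x ∈ 𝓡 i → y ∈ 𝓡 j → x * y ∈ 𝓡 (i + j)) {ι : Type u}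
    (deg : ι → ℤ) : GrMod.{u, u} R 𝓡 where
  carrier := ι →₀ R
  gr := freeGr 𝓡 deg
  isInternal := freeGr_isInternal h deg
  smul_mem := by
    intro i j r x hr hx l
    rw [Finsupp.smul_apply, smul_eq_mul, add_sub_assoc]
    exact hmul hr (hx l)

/-- A linear map out of a graded free module has degree zero if it does so on generators. -/
theorem linearCombination_mem_gr {ι : Type u} {deg : ι → ℤ} (N : GrMod.{u, u} R 𝓡) {v : ι → N}
    (hv : ∀ l, v l ∈ N.gr (deg l)) {j : ℤ} {q : ι →₀ R} (hq : q ∈ freeGr 𝓡 deg j) :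
    Finsupp.linearCombination R v q ∈ N.gr j := by
  rw [Finsupp.linearCombination_apply, Finsupp.sum]
  refine sum_mem fun l _ => ?_
  have := N.smul_mem (hq l) (hv l)
  rwa [sub_add_cancel] at this

end FreeGraded

/-! ### The `E₁`-complex as a complex of graded free `H(A)`-modules. -/

namespace DGModule.SemiFreeFiltration

variable {k : Type w} [Field k] {A : DGAlgebra.{w, u} k} {F M : DGModule.{w, u, u} A}
  {Φ : F.SemiFreeFiltration}

/-- The parity involution on relative cocycles. -/
noncomputable def relPar (Φ : F.SemiFreeFiltration) (i : ℕ) :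
    Φ.relCocycles i →+ Φ.relCocycles i :=
  (F.par.comp (Φ.relCocycles i).subtype).codRestrict (Φ.relCocycles i) fun x =>
    ⟨parity_mem F.isInternal (N := (Φ.fil i).toAddSubgroup) fun j => Φ.comp_mem_fil j x.2.1, by
      have h : F.par (F.d x) ∈ prev Φ.fil i :=
        parity_mem F.isInternal (N := (prev Φ.fil i).toAddSubgroup) fun j =>
          comp_mem_prev (fun j i x hx => Φ.comp_mem_fil j hx) j x.2.2
      rw [par_d] at h
      exact (neg_mem_iff (S := Submodule A F)).1 h⟩

theorem relPar_relPar (i : ℕ) (x : Φ.relCocycles i) : Φ.relPar i (Φ.relPar i x) = x :=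
  Subtype.ext (parity_parity F.isInternal (x : F))

theorem relPar_d1Rep (i : ℕ) (x : Φ.relCocycles (i + 1)) :
    Φ.relPar i (Φ.d1Rep i x) = -Φ.d1Rep i (Φ.relPar (i + 1) x) :=
  Subtype.ext (par_d (x : F))

namespace LevelBasis

variable (B : Φ.LevelBasis)

theorem repr_basis_of_ne {i : ℕ} {y : Σ i, B.ι i} {l : B.ι i} (h : y ≠ ⟨i, l⟩) (a : A) :
    B.b.repr (a • B.b y) ⟨i, l⟩ = 0 := by
  rw [map_smul, B.b.repr_self, Finsupp.smul_apply, Finsupp.single_eq_of_ne (Ne.symm h), smul_zero]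

theorem repr_basis_self (y : Σ i, B.ι i) (a : A) : B.b.repr (a • B.b y) y = a := by
  simp

/-- Differentiating basis vectors of level at most `i` lands in `F(i-1)`, so at level `i` only the
coefficients are differentiated: `F(i)/F(i-1)` is a sum of suspensions of `A`. -/
theorem repr_d {i : ℕ} {x : F} (hx : x ∈ Φ.fil i) (l : B.ι i) :
    B.b.repr (F.d x) ⟨i, l⟩ = A.d (B.b.repr x ⟨i, l⟩) := by
  classical
  refine B.prev_induction (i := i + 1)
    (p := fun x => B.b.repr (F.d x) ⟨i, l⟩ = A.d (B.b.repr x ⟨i, l⟩)) (by simp) ?_ ?_ hx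
  · intro x y hx hy
    simp only [map_add, Finsupp.add_apply, hx, hy]
  · intro m hm l' a
    have h0 : B.b.repr (A.par a • F.d (B.b ⟨m, l'⟩)) ⟨i, l⟩ = 0 :=
      (B.mem_prev_iff i _).1 (Submodule.smul_mem _ _
        (Φ.prev_mono (Nat.lt_succ_iff.1 hm) (B.d_mem m l'))) i le_rfl l
    rw [d_smul, map_add, Finsupp.add_apply, h0, add_zero]
    by_cases h : (⟨m, l'⟩ : Σ i, B.ι i) = ⟨i, l⟩
    · rw [← h, repr_basis_self, repr_basis_self]
    · rw [repr_basis_of_ne B h, repr_basis_of_ne B h, map_zero]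

theorem mem_prev_of_repr {i : ℕ} {x : F} (hx : x ∈ Φ.fil i)
    (h : ∀ l, B.b.repr x ⟨i, l⟩ = 0) : x ∈ prev Φ.fil i := by
  rw [B.mem_prev_iff]
  intro m hm l
  rcases hm.eq_or_lt with rfl | hlt
  · exact h l
  · exact (B.mem_fil_iff i x).1 hx m hlt l

/-- The coordinates at level `i` of a relative cocycle. -/
noncomputable def coord (i : ℕ) : Φ.relCocycles i →+ (B.ι i →₀ A.cocycles) :=
  AddMonoidHom.mk'
    (fun x => Finsupp.onFinset ((B.b.repr x).split i).support
      (fun l => ⟨B.b.repr x ⟨i, l⟩, by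
        change A.d _ = 0
        rw [← B.repr_d x.2.1]
        exact (B.mem_prev_iff i _).1 x.2.2 i le_rfl l⟩)
      (by
        intro l hl
        rw [Finsupp.mem_support_iff, Finsupp.split_apply]
        exact fun h => hl (Subtype.ext h)))
    (by
      intro x y
      ext l
      simp)

theorem coord_apply (i : ℕ) (x : Φ.relCocycles i) (l : B.ι i) :
    (B.coord i x l : A) = B.b.repr x ⟨i, l⟩ := rfl

/-- The multiples of a basis element by cocycles. -/
noncomputable def smulBasis (i : ℕ) (l : B.ι i) : A.cocycles →+ Φ.relCocycles i where
  toFun a := ⟨(a : A) • B.b ⟨i, l⟩, Submodule.smul_mem _ _ (B.mem_fil i l), by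
    have ha : A.d (a : A) = 0 := a.2
    rw [d_smul, ha, zero_smul, zero_add]
    exact Submodule.smul_mem _ _ (B.d_mem i l)⟩
  map_zero' := Subtype.ext (zero_smul _ _)
  map_add' a a' := Subtype.ext (add_smul _ _ _)

/-- The linear combinations of basis elements of level `i` whose coefficients are cocycles. -/
noncomputable def comb (i : ℕ) : (B.ι i →₀ A.cocycles) →+ Φ.relCocycles i :=
  Finsupp.liftAddHom (B.smulBasis i)

theorem coord_comb (i : ℕ) (c : B.ι i →₀ A.cocycles) : B.coord i (B.comb i c) = c := by
  suffices h : (B.coord i).comp (B.comb i) = AddMonoidHom.id _ from DFunLike.congr_fun h c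
  refine Finsupp.addHom_ext fun l a => ?_
  ext l'
  simp only [comb, AddMonoidHom.comp_apply, Finsupp.liftAddHom_apply_single, AddMonoidHom.id_apply]
  rw [coord_apply]
  change B.b.repr ((a : A) • B.b ⟨i, l⟩) ⟨i, l'⟩ = _
  by_cases h : l = l'
  · subst h
    rw [repr_basis_self, Finsupp.single_eq_same]
  · rw [repr_basis_of_ne B (fun e => h (by cases e; rfl)), Finsupp.single_eq_of_ne (Ne.symm h)]
    rfl

theorem sub_comb_mem_prev (i : ℕ) (x : Φ.relCocycles i) :
    ((x - B.comb i (B.coord i x) : Φ.relCocycles i) : F) ∈ prev Φ.fil i := by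
  refine B.mem_prev_of_repr (x - B.comb i (B.coord i x)).2.1 fun l => ?_
  rw [← coord_apply, map_sub, coord_comb, sub_self]
  rfl

/-- The class in `H(A)^{(ι i)} ≅ H(F(i)/F(i-1))` of a relative cocycle. -/
noncomputable def toFree (i : ℕ) : Φ.relCocycles i →+ (B.ι i →₀ A.H) :=
  (Finsupp.mapRange.addMonoidHom A.cls.toAddMonoidHom).comp (B.coord i)

theorem toFree_apply (i : ℕ) (x : Φ.relCocycles i) (l : B.ι i) :
    B.toFree i x l = A.cls (B.coord i x l) := rfl

theorem toFree_surjective (i : ℕ) : Function.Surjective (B.toFree i) := by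
  intro q
  obtain ⟨c, rfl⟩ := Finsupp.mapRange_surjective (α := B.ι i) A.cls (map_zero _)
    Ideal.Quotient.mk_surjective q
  refine ⟨B.comb i c, ?_⟩
  ext l
  rw [toFree_apply, coord_comb]
  rfl

/-- Cohomology commutes with direct sums; with `toFree_surjective` this identifies `E₁` at level `i`
with the free module on `ι i`. -/
theorem toFree_eq_zero_iff (i : ℕ) (x : Φ.relCocycles i) :
    B.toFree i x = 0 ↔ (x : F) ∈ Φ.relCoboundaries i := by
  classical
  constructor
  · intro h
    -- Primitives are taken to be `0` where the coordinate is, so that they form a finitely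
    -- supported family.
    have hl : ∀ l, ∃ y, A.d y = B.b.repr x ⟨i, l⟩ ∧ (B.b.repr x ⟨i, l⟩ = 0 → y = 0) := by
      intro l
      by_cases h0 : B.b.repr x ⟨i, l⟩ = 0
      · exact ⟨0, by rw [h0, map_zero], fun _ => rfl⟩
      · have := DFunLike.congr_fun h l
        rw [toFree_apply, Finsupp.zero_apply, DGAlgebra.cls_eq_zero_iff, coord_apply] at this
        obtain ⟨y, hy⟩ := this
        exact ⟨y, hy, fun h => absurd h h0⟩
    choose y hy hy0 using hl
    let c : B.ι i →₀ A := Finsupp.onFinset ((B.b.repr x).split i).support y (by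
      intro l hl
      rw [Finsupp.mem_support_iff, Finsupp.split_apply]
      exact fun h => hl (hy0 l h))
    let t : F := c.sum fun l a => a • B.b ⟨i, l⟩
    have ht : t ∈ Φ.fil i := sum_mem fun l _ => Submodule.smul_mem _ _ (B.mem_fil i l)
    have htl : ∀ l, B.b.repr t ⟨i, l⟩ = y l := by
      intro l
      simp only [t, Finsupp.sum, map_sum, Finsupp.finsetSum_apply]
      rw [Finset.sum_eq_single l]
      · rw [repr_basis_self]
        rfl
      · intro l' _ hne
        exact repr_basis_of_ne B (fun e => hne (by cases e; rfl)) _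
      · intro hl
        rw [Finsupp.notMem_support_iff.1 hl, zero_smul, map_zero, Finsupp.zero_apply]
    refine AddSubgroup.mem_sup.2 ⟨x - F.d t, ?_, F.d t, ⟨t, ht, rfl⟩, sub_add_cancel _ _⟩
    refine B.mem_prev_of_repr (sub_mem x.2.1 ((Φ.isDGSubmodule i).d_mem t ht)) fun l => ?_
    rw [map_sub, Finsupp.sub_apply, B.repr_d ht, htl, hy, sub_self]
  · intro h
    obtain ⟨u, hu, _, ⟨t, ht, rfl⟩, hut⟩ := AddSubgroup.mem_sup.1 h
    ext l
    rw [toFree_apply, Finsupp.zero_apply, DGAlgebra.cls_eq_zero_iff]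
    refine ⟨B.b.repr t ⟨i, l⟩, ?_⟩
    rw [coord_apply, ← B.repr_d ht, ← hut, map_add, Finsupp.add_apply,
      (B.mem_prev_iff i u).1 hu i le_rfl l, zero_add]

theorem toFree_eq_zero_iff_mk (i : ℕ) (x : Φ.relCocycles i) :
    B.toFree i x = 0 ↔ (QuotientAddGroup.mk x : Φ.E1 i) = 0 := by
  rw [toFree_eq_zero_iff, QuotientAddGroup.eq_zero_iff, AddSubgroup.mem_addSubgroupOf]

theorem toFree_eq_iff_mk (i : ℕ) (x y : Φ.relCocycles i) :
    B.toFree i x = B.toFree i y ↔ (QuotientAddGroup.mk x : Φ.E1 i) = QuotientAddGroup.mk y := by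
  rw [← sub_eq_zero, ← map_sub, toFree_eq_zero_iff_mk]
  exact sub_eq_zero (a := (QuotientAddGroup.mk x : Φ.E1 i)) (b := QuotientAddGroup.mk y)

theorem toFree_eq_of_sub_mem {i : ℕ} {x y : Φ.relCocycles i}
    (h : ((x - y : Φ.relCocycles i) : F) ∈ Φ.relCoboundaries i) : B.toFree i x = B.toFree i y := by
  rw [← sub_eq_zero, ← map_sub, toFree_eq_zero_iff]
  exact h

theorem toFree_smul (i : ℕ) (a : A.cocycles) {x y : Φ.relCocycles i}
    (h : (y : F) = (a : A) • (x : F)) : B.toFree i y = A.cls a • B.toFree i x := by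
  ext l
  change A.cls (B.coord i y l) = A.cls a * A.cls (B.coord i x l)
  rw [← map_mul]
  congr 1
  apply Subtype.ext
  rw [coord_apply, h, map_smul]
  rfl

/-- The differential of a basis element, as a relative cocycle. -/
noncomputable def dBasis (i : ℕ) (l : B.ι (i + 1)) : Φ.relCocycles i :=
  Φ.d1Rep i ⟨B.b ⟨i + 1, l⟩, B.mem_fil _ l, B.d_mem _ l⟩

theorem coe_dBasis (i : ℕ) (l : B.ι (i + 1)) :
    (B.dBasis i l : F) = F.d (B.b ⟨i + 1, l⟩) := rfl

/-- The differential of the complex of free `H(A)`-modules isomorphic to the `E₁`-complex. -/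
noncomputable def freeD (i : ℕ) : (B.ι (i + 1) →₀ A.H) →ₗ[A.H] (B.ι i →₀ A.H) :=
  Finsupp.linearCombination A.H fun l =>
    ((B.deg (i + 1) l).negOnePow : ℤ) • B.toFree i (B.dBasis i l)

/-- The map `[x] ↦ [∂x]` is `H(A)`-linear only up to sign. Applying parity first cancels the sign on
coefficients and leaves `(-1)^deg` on each basis vector, which is the factor built into `freeD`. -/
theorem freeD_toFree (i : ℕ) (x : Φ.relCocycles (i + 1)) :
    B.freeD i (B.toFree (i + 1) x) = B.toFree i (Φ.d1Rep i (Φ.relPar (i + 1) x)) := by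
  have key : ((B.freeD i).toAddMonoidHom.comp (B.toFree (i + 1))).comp (B.comb (i + 1))
      = (((B.toFree i).comp (Φ.d1Rep i)).comp (Φ.relPar (i + 1))).comp (B.comb (i + 1)) := by
    refine Finsupp.addHom_ext fun l a => ?_
    have h1 : B.toFree (i + 1) (B.comb (i + 1) (Finsupp.single l a))
        = Finsupp.single l (A.cls a) := by
      ext l'
      rw [toFree_apply, coord_comb]
      by_cases h : l = l'
      · subst h
        rw [Finsupp.single_eq_same, Finsupp.single_eq_same]
      · rw [Finsupp.single_eq_of_ne (Ne.symm h), Finsupp.single_eq_of_ne (Ne.symm h), map_zero]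
    change B.freeD i (B.toFree (i + 1) (B.comb (i + 1) (Finsupp.single l a)))
      = B.toFree i (Φ.d1Rep i (Φ.relPar (i + 1) (B.comb (i + 1) (Finsupp.single l a))))
    rw [h1, freeD, Finsupp.linearCombination_single, ← map_zsmul]
    symm
    refine B.toFree_smul i a ?_
    have h2 : B.comb (i + 1) (Finsupp.single l a) = B.smulBasis (i + 1) l a :=
      Finsupp.liftAddHom_apply_single _ _ _
    rw [h2]
    change F.d (F.par ((a : A) • B.b ⟨i + 1, l⟩))
      = (a : A) • (((B.deg (i + 1) l).negOnePow : ℤ) • F.d (B.b ⟨i + 1, l⟩))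
    have hda : A.d (A.par (a : A)) = 0 := by
      have : A.par (A.d (a : A)) = -A.d (A.par (a : A)) :=
        parity_degree_one A.isInternal A.d.toAddMonoidHom (fun _ _ hx => A.d_mem hx) (a : A)
      rw [show A.d (a : A) = 0 from a.2, map_zero] at this
      exact neg_eq_zero.1 this.symm
    have hpb : F.par (B.b ⟨i + 1, l⟩) = ((B.deg (i + 1) l).negOnePow : ℤ) • B.b ⟨i + 1, l⟩ :=
      parity_of_mem F.isInternal (B.mem_gr _ _)
    rw [par_smul, d_smul, hda, zero_smul, zero_add, parity_parity, hpb, map_zsmul]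
  have hx := DFunLike.congr_fun key (B.coord (i + 1) x)
  have hp := B.sub_comb_mem_prev (i + 1) x
  have e1 : B.toFree (i + 1) (B.comb (i + 1) (B.coord (i + 1) x)) = B.toFree (i + 1) x := by
    symm
    exact B.toFree_eq_of_sub_mem (AddSubgroup.mem_sup_left hp)
  have e2 : B.toFree i (Φ.d1Rep i (Φ.relPar (i + 1) (B.comb (i + 1) (B.coord (i + 1) x))))
      = B.toFree i (Φ.d1Rep i (Φ.relPar (i + 1) x)) := by
    symm
    apply B.toFree_eq_of_sub_mem
    rw [← map_sub, ← map_sub]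
    refine AddSubgroup.mem_sup_right ⟨F.par _, ?_, rfl⟩
    exact parity_mem F.isInternal (N := (Φ.fil i).toAddSubgroup)
      fun j => Φ.comp_mem_fil j hp
  rw [← e1, ← e2]
  exact hx

theorem freeD_exact {ε : DGHom F M} (hE : Φ.E1Exact ε) (i : ℕ) :
    Function.Exact (B.freeD (i + 1)) (B.freeD i) := by
  intro y
  constructor
  · intro hy
    obtain ⟨x, rfl⟩ := B.toFree_surjective _ y
    rw [freeD_toFree, toFree_eq_zero_iff_mk] at hy
    obtain ⟨t', ht⟩ := (hE.exact_succ i (QuotientAddGroup.mk (Φ.relPar (i + 1) x))).1 hy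
    obtain ⟨t, rfl⟩ := QuotientAddGroup.mk_surjective t'
    have ht' : B.toFree (i + 1) (Φ.d1Rep (i + 1) t) = B.toFree (i + 1) (Φ.relPar (i + 1) x) :=
      (B.toFree_eq_iff_mk _ _ _).2 ht
    -- Parity anticommutes with `∂`, whence the minus sign; since parity preserves coboundaries and
    -- squares to the identity, exactness survives the twist.
    refine ⟨B.toFree (i + 2) (-t), ?_⟩
    rw [freeD_toFree, map_neg, map_neg, ← relPar_d1Rep]
    rw [← sub_eq_zero, ← map_sub, toFree_eq_zero_iff] at ht' ⊢
    obtain ⟨u, hu, _, ⟨s, hs, rfl⟩, hus⟩ := AddSubgroup.mem_sup.1 ht'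
    have h1 : ((Φ.relPar (i + 1) (Φ.d1Rep (i + 1) t) - x : Φ.relCocycles (i + 1)) : F)
        = F.par u + F.d (-F.par s) := by
      have h2 : Φ.relPar (i + 1) (Φ.d1Rep (i + 1) t) - x
          = Φ.relPar (i + 1) (Φ.d1Rep (i + 1) t - Φ.relPar (i + 1) x) := by
        rw [map_sub, relPar_relPar]
      rw [h2]
      change F.par ((Φ.d1Rep (i + 1) t - Φ.relPar (i + 1) x : Φ.relCocycles (i + 1)) : F) = _
      rw [← hus, map_add, par_d, map_neg]
    rw [h1]
    refine add_mem (AddSubgroup.mem_sup_left ?_) (AddSubgroup.mem_sup_right ⟨_, ?_, rfl⟩)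
    · exact parity_mem F.isInternal (N := (Φ.fil i).toAddSubgroup)
        fun j => Φ.comp_mem_fil j hu
    · exact neg_mem (parity_mem F.isInternal (N := (Φ.fil (i + 1)).toAddSubgroup)
        fun j => Φ.comp_mem_fil j hs)
  · rintro ⟨y, rfl⟩
    obtain ⟨t, rfl⟩ := B.toFree_surjective _ y
    rw [freeD_toFree, freeD_toFree, relPar_d1Rep, map_neg, map_neg, neg_eq_zero]
    have : Φ.d1Rep i (Φ.d1Rep (i + 1) (Φ.relPar (i + 2) (Φ.relPar (i + 2) t))) = 0 :=
      Subtype.ext (F.d_d _)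
    rw [this, map_zero]

/-- The augmentation of the complex of free `H(A)`-modules isomorphic to the `E₁`-complex. -/
noncomputable def freeAug (ε : DGHom F M) : (B.ι 0 →₀ A.H) →ₗ[A.H] M.H :=
  Finsupp.linearCombination A.H fun l =>
    (M.cls (Φ.augRep ε ⟨B.b ⟨0, l⟩, B.mem_fil _ l, B.d_mem _ l⟩) : M.H)

theorem freeAug_toFree (ε : DGHom F M) (x : Φ.relCocycles 0) :
    B.freeAug ε (B.toFree 0 x) = Φ.aug ε (QuotientAddGroup.mk x) := by
  have key : ((B.freeAug ε).toAddMonoidHom.comp (B.toFree 0)).comp (B.comb 0)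
      = ((Φ.aug ε).comp (QuotientAddGroup.mk' _)).comp (B.comb 0) := by
    refine Finsupp.addHom_ext fun l a => ?_
    have h1 : B.toFree 0 (B.comb 0 (Finsupp.single l a)) = Finsupp.single l (A.cls a) := by
      ext l'
      rw [toFree_apply, coord_comb]
      by_cases h : l = l'
      · subst h
        rw [Finsupp.single_eq_same, Finsupp.single_eq_same]
      · rw [Finsupp.single_eq_of_ne (Ne.symm h), Finsupp.single_eq_of_ne (Ne.symm h), map_zero]
    have h2 : B.comb 0 (Finsupp.single l a) = B.smulBasis 0 l a :=
      Finsupp.liftAddHom_apply_single _ _ _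
    change B.freeAug ε (B.toFree 0 (B.comb 0 (Finsupp.single l a)))
      = M.cls (Φ.augRep ε (B.comb 0 (Finsupp.single l a)))
    rw [h1, h2]
    refine (Finsupp.linearCombination_single A.H (A.cls a) l).trans ?_
    refine congrArg M.cls (Subtype.ext ?_)
    exact (ε.toFun.map_smul (a : A) (B.b ⟨0, l⟩)).symm
  have hx := DFunLike.congr_fun key (B.coord 0 x)
  -- At level `0` the error term lies in `F(-1) = 0`.
  have hp : x - B.comb 0 (B.coord 0 x) = 0 := Subtype.ext (B.sub_comb_mem_prev 0 x)
  rw [sub_eq_zero] at hp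
  rw [hp]
  exact hx

theorem freeAug_surjective {ε : DGHom F M} (hE : Φ.E1Exact ε) :
    Function.Surjective (B.freeAug ε) := by
  intro y
  obtain ⟨x', rfl⟩ := hE.surjective_aug y
  obtain ⟨x, rfl⟩ := QuotientAddGroup.mk_surjective x'
  exact ⟨_, B.freeAug_toFree ε x⟩

theorem freeD_exact_freeAug {ε : DGHom F M} (hE : Φ.E1Exact ε) :
    Function.Exact (B.freeD 0) (B.freeAug ε) := by
  intro y
  obtain ⟨x, rfl⟩ := B.toFree_surjective _ y
  rw [freeAug_toFree, hE.exact_zero]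
  constructor
  · rintro ⟨t', ht⟩
    obtain ⟨t, rfl⟩ := QuotientAddGroup.mk_surjective t'
    refine ⟨B.toFree 1 (Φ.relPar 1 t), ?_⟩
    rw [freeD_toFree, relPar_relPar]
    exact (B.toFree_eq_iff_mk _ _ _).2 ht
  · rintro ⟨q, hq⟩
    obtain ⟨t, rfl⟩ := B.toFree_surjective _ q
    rw [freeD_toFree, toFree_eq_iff_mk] at hq
    exact ⟨QuotientAddGroup.mk (Φ.relPar 1 t), hq⟩

/-- The graded free `H(A)`-module isomorphic to `E₁^{-i,*}`, regraded so that the differentials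
have degree zero. -/
noncomputable def freeMod (i : ℕ) : GrMod.{u, u} A.H A.HGr :=
  GrMod.free A.HGr_isInternal DGAlgebra.mul_mem_HGr fun l : B.ι i => B.deg i l + i

theorem repr_mem_gr {j : ℤ} {x : F} (hx : x ∈ F.gr j) (i : ℕ) (l : B.ι i) :
    B.b.repr x ⟨i, l⟩ ∈ A.gr (j - B.deg i l) := by
  have := B.repr_comp j x i l
  rw [comp_eq_self hx] at this
  rw [this]
  exact grComp_mem A.isInternal _ _

/-- The differential raises internal degree by one, and the shift by the level in `freeMod`
compensates exactly for this. -/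
theorem freeD_mem (i : ℕ) (j : ℤ) {x : B.ι (i + 1) →₀ A.H}
    (hx : x ∈ freeGr A.HGr (fun l => B.deg (i + 1) l + (i + 1 : ℕ)) j) :
    B.freeD i x ∈ (B.freeMod i).gr j := by
  refine linearCombination_mem_gr (B.freeMod i) (fun l => ?_) hx
  refine zsmul_mem (K := (B.freeMod i).gr _) (fun l' => ?_) _
  rw [toFree_apply]
  apply DGAlgebra.cls_mem_HGr
  rw [coord_apply, coe_dBasis]
  have := B.repr_mem_gr (F.d_mem (B.mem_gr (i + 1) l)) i l'
  convert this using 2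
  push_cast
  ring

theorem freeAug_mem (ε : DGHom F M) (j : ℤ) {x : B.ι 0 →₀ A.H}
    (hx : x ∈ freeGr A.HGr (fun l => B.deg 0 l + (0 : ℕ)) j) : B.freeAug ε x ∈ M.H.gr j := by
  refine linearCombination_mem_gr M.H (fun l => ?_) hx
  refine ⟨_, ?_, rfl⟩
  have := ε.map_gr (B.mem_gr 0 l)
  rw [← add_zero (B.deg 0 l)] at this
  exact this

end LevelBasis

end DGModule.SemiFreeFiltration

/-! ### Syzygies and dimension shifting. -/

section Syzygies

open CategoryTheory

variable {R : Type u} [Ring R]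

/-- By exactness `E'/im f` embeds in the projective `E` with quotient `E/im g`, so it is a first
syzygy of that quotient. -/
theorem hasProjectiveDimensionLT_quotient_range_iff {E'' E' E : Type u} [AddCommGroup E'']
    [AddCommGroup E'] [AddCommGroup E] [Module R E''] [Module R E'] [Module R E]
    [Module.Projective R E] {f : E'' →ₗ[R] E'} {g : E' →ₗ[R] E} (hfg : Function.Exact f g)
    (n : ℕ) :
    HasProjectiveDimensionLT (ModuleCat.of R (E ⧸ LinearMap.range g)) (n + 2) ↔
      HasProjectiveDimensionLT (ModuleCat.of R (E' ⧸ LinearMap.range f)) (n + 1) := by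
  have hker : LinearMap.ker g = LinearMap.range f := hfg.linearMap_ker_eq
  let i : (E' ⧸ LinearMap.range f) →ₗ[R] E := (LinearMap.range f).liftQ g hker.ge
  have hi : Function.Injective i := by
    rw [← LinearMap.ker_eq_bot]
    exact Submodule.ker_liftQ_eq_bot _ _ _ hker.le
  have hrange : LinearMap.range i = LinearMap.range g := Submodule.range_liftQ _ _ _
  have hex : Function.Exact i (LinearMap.range g).mkQ := by
    rw [LinearMap.exact_iff, Submodule.ker_mkQ, hrange]
  let S : ShortComplex (ModuleCat.{u} R) :=
    ShortComplex.mk (ModuleCat.ofHom i) (ModuleCat.ofHom (LinearMap.range g).mkQ) (by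
      rw [← ModuleCat.ofHom_comp, hex.linearMap_comp_eq_zero]
      rfl)
  have hS : S.ShortExact :=
    ModuleCat.shortComplex_shortExact S hex hi (Submodule.mkQ_surjective _)
  have : Projective S.X₂ :=
    (IsProjective.iff_projective E).1 inferInstance
  exact hS.hasProjectiveDimensionLT_X₃_iff n this

/-- If `N` has a projective resolution of length `n`, then the cokernels of the differentials of
any projective resolution of `N` are projective from degree `n` on. -/
theorem projective_quotient_range_of_resolution {N : Type u} [AddCommGroup N] [Module R N]
    {P Q : ℕ → Type u} [∀ i, AddCommGroup (P i)] [∀ i, AddCommGroup (Q i)]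
    [∀ i, Module R (P i)] [∀ i, Module R (Q i)] [∀ i, Module.Projective R (P i)]
    [∀ i, Module.Projective R (Q i)] {δ : ∀ i, P (i + 1) →ₗ[R] P i} {ε : P 0 →ₗ[R] N}
    {δ' : ∀ i, Q (i + 1) →ₗ[R] Q i} {ε' : Q 0 →ₗ[R] N}
    (hε : Function.Surjective ε) (h0 : Function.Exact (δ 0) ε)
    (h1 : ∀ i, Function.Exact (δ (i + 1)) (δ i))
    (hε' : Function.Surjective ε') (h0' : Function.Exact (δ' 0) ε')
    (h1' : ∀ i, Function.Exact (δ' (i + 1)) (δ' i)) {n : ℕ}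
    (hn : ∀ i, n < i → Subsingleton (P i)) :
    Module.Projective R (Q n ⧸ LinearMap.range (δ' n)) := by
  -- Climb along `P` from the projective cokernel at `n` to `N`, the cokernel at `0`; then descend
  -- along `Q`, losing one dimension at each step.
  have hP : ∀ m ≤ n, HasProjectiveDimensionLT
      (ModuleCat.of R (P (n - m) ⧸ LinearMap.range (δ (n - m)))) (m + 1) := by
    intro m
    induction m with
    | zero =>
      intro _
      have hs := hn (n + 1) (Nat.lt_succ_self n)
      have hr : LinearMap.range (δ n) = ⊥ := by
        rw [LinearMap.range_eq_bot]
        ext x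
        rw [Subsingleton.elim x 0, map_zero, map_zero]
      have : Module.Projective R (P n ⧸ LinearMap.range (δ n)) :=
        Module.Projective.of_equiv ((LinearMap.range (δ n)).quotEquivOfEqBot hr).symm
      rw [zero_add, ← projective_iff_hasProjectiveDimensionLT_one]
      exact (IsProjective.iff_projective _).1 this
    | succ m ih =>
      intro hm
      obtain ⟨j, hj⟩ : ∃ j, n - m = j + 1 := ⟨n - m - 1, by lia⟩
      have ih' := ih (by lia)
      rw [hj] at ih'
      rw [show n - (m + 1) = j by lia]
      exact (hasProjectiveDimensionLT_quotient_range_iff (h1 j) m).2 ih'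
  have hQ : ∀ m ≤ n, HasProjectiveDimensionLT
      (ModuleCat.of R (Q m ⧸ LinearMap.range (δ' m))) (n - m + 1) := by
    intro m
    induction m with
    | zero =>
      intro _
      have h := hP n le_rfl
      rw [Nat.sub_self] at h
      let e : (P 0 ⧸ LinearMap.range (δ 0)) ≃ₗ[R] (Q 0 ⧸ LinearMap.range (δ' 0)) :=
        ((Submodule.quotEquivOfEq _ _ h0.linearMap_ker_eq.symm).trans
          (ε.quotKerEquivOfSurjective hε)).trans
        ((Submodule.quotEquivOfEq _ _ h0'.linearMap_ker_eq.symm).trans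
          (ε'.quotKerEquivOfSurjective hε')).symm
      exact hasProjectiveDimensionLT_of_iso e.toModuleIso _
    | succ m ih =>
      intro hm
      have ih' := ih (by lia)
      rw [show n - m + 1 = n - (m + 1) + 2 by lia] at ih'
      exact (hasProjectiveDimensionLT_quotient_range_iff (h1' m) _).1 ih'
  have h := hQ n le_rfl
  rw [Nat.sub_self, zero_add, ← projective_iff_hasProjectiveDimensionLT_one] at h
  exact (IsProjective.iff_projective _).2 h

/-- If the cokernel of `g` is projective, then `g` has a generalized inverse. -/
theorem exists_generalized_inverse {E' E : Type u} [AddCommGroup E'] [AddCommGroup E]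
    [Module R E'] [Module R E] [Module.Projective R E] (g : E' →ₗ[R] E)
    [Module.Projective R (E ⧸ LinearMap.range g)] :
    ∃ s : E →ₗ[R] E', ∀ x, g (s (g x)) = g x := by
  obtain ⟨t, ht⟩ := Module.projective_lifting_property (LinearMap.range g).mkQ LinearMap.id
    (Submodule.mkQ_surjective _)
  have hmem : ∀ x, x - t ((LinearMap.range g).mkQ x) ∈ LinearMap.range g := by
    intro x
    rw [← Submodule.Quotient.mk_eq_zero, ← Submodule.mkQ_apply, map_sub]
    have := LinearMap.congr_fun ht ((LinearMap.range g).mkQ x)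
    rw [LinearMap.comp_apply, LinearMap.id_apply] at this
    rw [this, sub_self]
  -- Projection onto the image of `g`, along the complement given by the section `t`; lifting it
  -- through `g` yields `s`.
  let p : E →ₗ[R] LinearMap.range g :=
    (LinearMap.id - t ∘ₗ (LinearMap.range g).mkQ).codRestrict _ hmem
  obtain ⟨s, hs⟩ := Module.projective_lifting_property g.rangeRestrict p
    g.surjective_rangeRestrict
  refine ⟨s, fun x => ?_⟩
  have h1 := congrArg Subtype.val (LinearMap.congr_fun hs (g x))
  have h2 : (LinearMap.range g).mkQ (g x) = 0 :=
    (Submodule.Quotient.mk_eq_zero _).2 ⟨x, rfl⟩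
  change g (s (g x)) = g x - t ((LinearMap.range g).mkQ (g x)) at h1
  rw [h1, h2, map_zero, sub_zero]

end Syzygies

/-! ### Minimality over `H(A)` and vanishing of levels. -/

namespace DGAlgebra

variable {k : Type w} [Field k] {A : DGAlgebra.{w, u} k}

/-- The ideal of the classes of cocycles without component in degree zero. -/
def HIdeal (hA : A.IsConnected) : Ideal A.H where
  carrier := {q | ∃ a : A.cocycles, grComp A.isInternal 0 (a : A) = 0 ∧ A.cls a = q}
  add_mem' := by
    rintro _ _ ⟨a, ha, rfl⟩ ⟨b, hb, rfl⟩
    exact ⟨a + b, by change grComp A.isInternal 0 ((a : A) + b) = 0; rw [map_add, ha, hb, add_zero],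
      map_add _ _ _⟩
  zero_mem' := ⟨0, map_zero _, map_zero _⟩
  smul_mem' := by
    rintro q _ ⟨a, ha, rfl⟩
    obtain ⟨b, rfl⟩ := Ideal.Quotient.mk_surjective q
    refine ⟨b * a, ?_, map_mul _ _ _⟩
    change grComp A.isInternal 0 ((b : A) * a) = 0
    rw [grComp_zero_mul hA, ha, mul_zero]

theorem mul_mem_HIdeal (hA : A.IsConnected) {q : A.H} (hq : q ∈ HIdeal hA) (r : A.H) :
    q * r ∈ HIdeal hA := by
  obtain ⟨a, ha, rfl⟩ := hq
  obtain ⟨b, rfl⟩ := Ideal.Quotient.mk_surjective r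
  refine ⟨a * b, ?_, map_mul _ _ _⟩
  change grComp A.isInternal 0 ((a : A) * b) = 0
  rw [grComp_zero_mul hA, ha, zero_mul]

/-- Otherwise `1 - a` would be a coboundary with degree-zero component `1`, whereas coboundaries
have none. -/
theorem one_notMem_HIdeal (hA : A.IsConnected) : (1 : A.H) ∉ HIdeal hA := by
  rintro ⟨a, ha, h⟩
  have h0 : A.cls (1 - a) = 0 := by rw [map_sub, h, map_one, sub_self]
  obtain ⟨y, hy⟩ := (cls_eq_zero_iff _).1 h0
  have h1 := grComp_zero_d hA y
  rw [hy] at h1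
  change grComp A.isInternal 0 ((1 : A) - a) = 0 at h1
  rw [map_sub, ha, sub_zero, grComp_same A.isInternal (show (1 : A) ∈ A.grAdd 0 from A.one_mem)]
    at h1
  have := hA.nontrivial
  exact one_ne_zero h1

/-- The elements of a free `H(A)`-module all of whose coordinates are in `HIdeal`. -/
def HIdealFree (hA : A.IsConnected) (ι : Type u) : Submodule A.H (ι →₀ A.H) where
  carrier := {q | ∀ l, q l ∈ HIdeal hA}
  add_mem' hp hq l := add_mem (hp l) (hq l)
  zero_mem' _ := zero_mem _
  smul_mem' r _ hq l := Ideal.mul_mem_left _ r (hq l)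

theorem map_HIdealFree (hA : A.IsConnected) {ι κ : Type u} (φ : (ι →₀ A.H) →ₗ[A.H] (κ →₀ A.H))
    {q : ι →₀ A.H} (hq : q ∈ HIdealFree hA ι) : φ q ∈ HIdealFree hA κ := by
  rw [← Finsupp.sum_single q, Finsupp.sum, map_sum]
  refine sum_mem fun l _ => ?_
  have : Finsupp.single l (q l) = q l • Finsupp.single l (1 : A.H)  :=
    (Finsupp.smul_single_one l (q l)).symm
  rw [this, map_smul]
  intro j
  exact mul_mem_HIdeal hA (hq l) _

theorem isEmpty_of_HIdealFree_eq_top (hA : A.IsConnected) {ι : Type u}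
    (h : ∀ q, q ∈ HIdealFree hA ι) : IsEmpty ι := by
  refine ⟨fun l => one_notMem_HIdeal hA ?_⟩
  have := h (Finsupp.single l 1) l
  rwa [Finsupp.single_eq_same] at this

end DGAlgebra

namespace DGModule.SemiFreeFiltration.LevelBasis

variable {k : Type w} [Field k] {A : DGAlgebra.{w, u} k} {F M : DGModule.{w, u, u} A}
  {Φ : F.SemiFreeFiltration} (B : Φ.LevelBasis)

/-- Minimality of the complex of free `H(A)`-modules of a minimal semi-free DG module. -/
theorem freeD_mem_HIdealFree (hA : A.IsConnected) (hmin : F.IsMinimal) (i : ℕ)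
    (q : B.ι (i + 1) →₀ A.H) : B.freeD i q ∈ DGAlgebra.HIdealFree hA (B.ι i) := by
  rw [freeD, Finsupp.linearCombination_apply, Finsupp.sum]
  refine sum_mem fun l _ => Submodule.smul_mem _ _ (zsmul_mem (fun l' => ?_) _)
  refine ⟨B.coord i (B.dBasis i l) l', ?_, rfl⟩
  rw [coord_apply, coe_dBasis]
  exact grComp_zero_repr hA B.b (hmin _) _

/-- If the cokernel of the differential `Q(n+1) → Q(n)` of the minimal free complex is projective,
then `Q(n+1) = 0`. -/
theorem isEmpty_of_projective (hA : A.IsConnected) (hmin : F.IsMinimal) {ε : DGHom F M}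
    (hE : Φ.E1Exact ε) (n : ℕ)
    [Module.Projective A.H ((B.ι n →₀ A.H) ⧸ LinearMap.range (B.freeD n))] :
    IsEmpty (B.ι (n + 1)) := by
  obtain ⟨s, hs⟩ := exists_generalized_inverse (B.freeD n)
  refine DGAlgebra.isEmpty_of_HIdealFree_eq_top hA fun q => ?_
  have h0 : B.freeD n (q - s (B.freeD n q)) = 0 := by
    rw [map_sub, hs, sub_self]
  obtain ⟨q', hq'⟩ := (B.freeD_exact hE n _).1 h0
  -- The first summand is in the image of the next differential and the second is a linear image of
  -- `freeD n q`. Minimality puts all coordinates of both in the ideal.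
  rw [← sub_add_cancel q (s (B.freeD n q)), ← hq']
  exact add_mem (B.freeD_mem_HIdealFree hA hmin _ _)
    (DGAlgebra.map_HIdealFree hA s (B.freeD_mem_HIdealFree hA hmin _ _))

/-- If `Q(n) = 0`, exactness makes `Q(n+1)` the image of a minimal differential, so all its
coordinates lie in a proper ideal. -/
theorem isEmpty_succ (hA : A.IsConnected) (hmin : F.IsMinimal) {ε : DGHom F M}
    (hE : Φ.E1Exact ε) (n : ℕ) (hn : IsEmpty (B.ι n)) : IsEmpty (B.ι (n + 1)) := by
  refine DGAlgebra.isEmpty_of_HIdealFree_eq_top hA fun q => ?_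
  obtain ⟨q', rfl⟩ := (B.freeD_exact hE n q).1 (Subsingleton.elim _ _)
  exact B.freeD_mem_HIdealFree hA hmin _ _

theorem fil_eq_top {n : ℕ} (h : ∀ m, n < m → IsEmpty (B.ι m)) : Φ.fil n = ⊤ := by
  rw [eq_top_iff]
  intro x _
  rw [B.mem_fil_iff]
  intro m hm l
  exact ((h m hm).false l).elim

theorem isEmpty_of_prev_eq {i : ℕ} (h : prev Φ.fil i = Φ.fil i) [Nontrivial A] :
    IsEmpty (B.ι i) := by
  refine ⟨fun l => ?_⟩
  have h1 : B.b ⟨i, l⟩ ∈ prev Φ.fil i := by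
    rw [h]
    exact B.mem_fil i l
  have h2 := (B.mem_prev_iff i _).1 h1 i le_rfl l
  rw [B.b.repr_self, Finsupp.single_eq_same] at h2
  exact one_ne_zero h2

theorem prev_eq_top {i : ℕ} (h : ∀ m, i ≤ m → IsEmpty (B.ι m)) : prev Φ.fil i = ⊤ := by
  rw [eq_top_iff]
  intro x _
  rw [B.mem_prev_iff]
  intro m hm l
  exact ((h m hm).false l).elim

end DGModule.SemiFreeFiltration.LevelBasis

/-! ### Strictness of the filtration and the two inequalities. -/

/-- A stationary step means an empty level, and by `isEmpty_succ` all later levels are then empty,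
so the filtration has already reached `F`. -/
theorem DGModule.SemiFreeFiltration.isStrict_of_isMinimal {k : Type w} [Field k]
    {A : DGAlgebra.{w, u} k} {F M : DGModule.{w, u, u} A} {Φ : F.SemiFreeFiltration}
    (hA : A.IsConnected) (hmin : F.IsMinimal) {ε : DGHom F M}
    (hE : Φ.E1Exact ε) : Φ.IsStrict := by
  have := hA.nontrivial
  obtain ⟨B⟩ := Φ.nonempty_levelBasis
  intro i hi heq
  apply hi
  apply B.prev_eq_top
  intro m hm
  induction m, hm using Nat.le_induction with
  | base => exact B.isEmpty_of_prev_eq heq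
  | succ m _ ih => exact B.isEmpty_succ hA hmin hE m ih

theorem mainTheorem4 {k : Type w} [Field k] (A : DGAlgebra.{w, u} k) (hA : A.IsConnected)
    (M : DGModule.{w, u, u} A) (hM : M.CohomologyBoundedBelow)
    (hEM : M.AdmitsMinimalEilenbergMooreResolution) :
    M.coneLength = M.H.projectiveDimension := by
  classical
  obtain ⟨F, ε, ⟨hε, Φ, hE⟩, hmin⟩ := hEM
  obtain ⟨B⟩ := Φ.nonempty_levelBasis
  apply le_antisymm
  · refine le_sInf ?_
    rintro _ ⟨n, rfl, P, δ, ε', hP, -, -, hs, h0, h1, hn⟩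
    have hempty : ∀ m, n < m → IsEmpty (B.ι m) := by
      intro m hm
      -- Since `n ≤ j`, the resolution of length `n` is also one of length `j`, which removes level
      -- `j + 1`.
      obtain ⟨j, rfl⟩ : ∃ j, m = j + 1 := ⟨m - 1, by lia⟩
      have := projective_quotient_range_of_resolution (R := A.H) (P := fun i => P i)
        (Q := fun i => B.ι i →₀ A.H) (δ' := B.freeD) hs h0 h1 (B.freeAug_surjective hE)
        (B.freeD_exact_freeAug hE) (B.freeD_exact hE) (n := j) (fun i hi => hn i (by lia))
      exact B.isEmpty_of_projective hA hmin hE j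
    have htop : ∃ m, Φ.fil m = ⊤ := ⟨n, B.fil_eq_top hempty⟩
    have h1 : M.coneLength ≤ F.dgFreeClass := sInf_le ⟨F, ε, ⟨⟨Φ⟩, hε⟩, rfl⟩
    -- The length is the least index reaching `F`, which may be smaller than `n`.
    have h2 : F.dgFreeClass ≤ (Nat.find htop : ℕ) := sInf_le ⟨Nat.find htop, Φ, rfl,
      DGModule.SemiFreeFiltration.isStrict_of_isMinimal hA hmin hE, Nat.find_spec htop, fun m hm => Nat.find_min htop hm⟩
    refine h1.trans (h2.trans ?_)
    exact_mod_cast Nat.find_min' htop (B.fil_eq_top hempty)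
  · refine le_sInf ?_
    rintro _ ⟨G, η, ⟨-, hη⟩, rfl⟩
    refine le_sInf ?_
    rintro _ ⟨n, Ψ, rfl, -, hn, -⟩
    have hempty := DGModule.isEmpty_of_isSemiFreeResolution hA B hε hE hmin hη Ψ hn
    refine sInf_le ⟨n, rfl, B.freeMod, B.freeD, B.freeAug ε, fun i => ?_,
      fun i j x hx => B.freeD_mem i j hx, fun j x hx => B.freeAug_mem ε j hx,
      B.freeAug_surjective hE, B.freeD_exact_freeAug hE, B.freeD_exact hE, fun i hi => ?_⟩
    · exact inferInstanceAs (Module.Projective A.H (B.ι i →₀ A.H))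
    · have := hempty i hi
      exact inferInstanceAs (Subsingleton (B.ι i →₀ A.H))
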